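/- Let $I=(0,1)$ and $I(h)=\{s\in I: s+h\in I\}$. For measurable $f$ on $A\subseteq I$ put $\|f\|_{L^{\Phi_2}(A)}=\sup_{p\ge 1}p^{-1/2}\|f\|_{L^p(A)}$ (the norm of the exponential Orlicz space with Young function $\Phi_2(x)=e^{x^2}-1$), and for $\alpha\in(0,1)$ let $\mathcal B^{\alpha}_{\Phi_2,\infty}(I)$ be the space of (classes of) measurable functions $f$ on $I$ with $$\|f\|_{L^{\Phi_2}(I)}+\sup_{0<t\le 1}t^{-\alpha}\sup_{|h|\le t}\|f(\cdot+h)-f(\cdot)\|_{L^{\Phi_2}(I(h))}<\infty .$$ Theorem. Let $H\in(0,1)$ and $K\in(0,2]$ be such that $HK\in(0,1)$. Let $B^{H,K}=\{B^{H,K}_t,\ t\ge 0\}$ be a bifractional Brownian motion with parameters $H,K$, that is, a centred Gaussian process with covariance function $$R^{H,K}(t,s)=2^{-K}\bigl((t^{2H}+s^{2H})^K-|t-s|^{2HK}\bigr),\qquad s,t\ge 0,$$ and suppose that $(t,\omega)\mapsto B^{H,K}_t(\omega)$ is jointly measurable on $I\times\Omega$ up to a null set of $dt\otimes\mathbb P$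 (for instance, that $B^{H,K}$ has almost surely continuous paths). Then, almost surely, the path $t\mapsto B^{H,K}_t$ restricted to $I$ belongs to $\mathcal B^{HK}_{\Phi_2,\infty}(I)$. -/

import Mathlib

open MeasureTheory ProbabilityTheory Set
open scoped NNReal ENNReal

noncomputable section

/-- The set `I(h) = {s ∈ I : s + h ∈ I}` for the interval `I = (0, 1)`. -/
def shiftInterval (h : ℝ) : Set ℝ := {s | s ∈ Ioo (0 : ℝ) 1 ∧ s + h ∈ Ioo (0 : ℝ) 1}

/-- The norm `sup_{p ≥ 1} p^{-1/β} ‖f‖_{L^p(A)}` (over real `p`) of the exponential Orlicz space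
`L^{Φ_β}(A)` with Young function `Φ_β(x) = exp (x^β) - 1`; the value is `∞` outside the space. -/
def expOrliczNorm (β : ℝ) (f : ℝ → ℝ) (A : Set ℝ) : ℝ≥0∞ :=
  ⨆ p : ℝ, ⨆ _ : 1 ≤ p,
    ENNReal.ofReal (p ^ (-(1 / β))) * eLpNorm f (ENNReal.ofReal p) (volume.restrict A)

/-- The modulus of smoothness `sup_{|h| ≤ t} ‖f(· + h) - f(·)‖_{L^{Φ_β}(I(h))}`. -/
def orliczModulus (β : ℝ) (f : ℝ → ℝ) (t : ℝ) : ℝ≥0∞ :=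
  ⨆ h : ℝ, ⨆ _ : |h| ≤ t, expOrliczNorm β (fun s => f (s + h) - f s) (shiftInterval h)

/-- The seminorm `sup_{0 < t ≤ 1} t^{-α} ω(f, t)`. -/
def besovOrliczSeminorm (α β : ℝ) (f : ℝ → ℝ) : ℝ≥0∞ :=
  ⨆ t : ℝ, ⨆ _ : t ∈ Ioc (0 : ℝ) 1, ENNReal.ofReal (t ^ (-α)) * orliczModulus β f t

/-- Membership of (the restriction to `I = (0, 1)` of) `f` in the Besov-Orlicz space
`B^α_{Φ_β,∞}(I)`: `f` is measurable on `I` up to null sets, and the norm of the space, that is the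
sum of the `L^{Φ_β}(I)`-norm and the seminorm, is finite. Only the values of `f` on `I` matter. -/
def MemBesovOrlicz (α β : ℝ) (f : ℝ → ℝ) : Prop :=
  AEStronglyMeasurable f (volume.restrict (Ioo (0 : ℝ) 1)) ∧
    expOrliczNorm β f (Ioo (0 : ℝ) 1) + besovOrliczSeminorm α β f < ∞

/-- The covariance function
`R(t, s) = 2^{-K} ((t^{2H} + s^{2H})^K - |t - s|^{2HK})` of bifractional Brownian motion. -/
def bifractionalCov (H K : ℝ) (t s : ℝ≥0) : ℝ :=
  2 ^ (-K) * (((t : ℝ) ^ (2 * H) + (s : ℝ) ^ (2 * H)) ^ K - |(t : ℝ) - (s : ℝ)| ^ (2 * H * K))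

/-- `B` is a bifractional Brownian motion with parameters `H`, `K`: a centred Gaussian process
indexed by `[0, ∞)` with covariance function `bifractionalCov H K`. -/
structure IsBifractionalBM {Ω : Type*} [MeasurableSpace Ω] (H K : ℝ) (B : ℝ≥0 → Ω → ℝ)
    (P : Measure Ω) : Prop where
  isGaussianProcess : IsGaussianProcess B P
  centred : ∀ t, ∫ ω, B t ω ∂P = 0
  covariance : ∀ t s, ∫ ω, B t ω * B s ω ∂P = bifractionalCov H K t s

end

open Filter Topology

/-! The norm asks for `L^p` bounds of order `√p`, which follow from a bound on the integral of `exp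
(f ^ 2 / (8 σ ^ 2))`, with the constant proportional to `σ`. Since `h ↦ ‖f (· + h) - f‖_p` is
subadditive on `h ≥ 0`, binary expansion and a geometric series reduce all shifts to `h = 2 ^ (-n)`
(`memBesovOrlicz_of_dyadic`). It remains to bound, uniformly in `n` and almost surely, `Z_n = ∫ exp
(X_n(t) ^ 2 / 8) dt` over `I(2 ^ (-n))`, where `X_n` is the increment process divided by `√V 2 ^
(-nHK)`, so that its variance is at most one.

Bounded variance bounds the means of `Z_n`. Their variances are at most a constant times the double
integral of `|E X_n(t) X_n(s)|` (`lintegral_expSq_mul_le`). Increments over intervals at distance of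
order `d` from each other and from the origin have covariance `O(d ^ (-6) h ^ 2)`, a mixed second
difference of a smooth function; the remaining pairs `(t, s)` have measure `O(d)`. With `d` a small
power of `h`, possible because `HK < 1`, the double integral is `O(d)`, which is summable along `h =
2 ^ (-n)`. Chebyshev's inequality and the Borel-Cantelli lemma conclude
(`ae_exists_forall_le_of_sq_le`). -/

/-! ### Reduction of the Besov-Orlicz norm to dyadic shifts. -/

lemma measurableSet_shiftInterval (h : ℝ) : MeasurableSet (shiftInterval h) :=
  measurableSet_Ioo.inter (measurable_add_const h measurableSet_Ioo)

lemma shiftInterval_anti {a b : ℝ} (ha : 0 ≤ a) (hab : a ≤ b) :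
    shiftInterval b ⊆ shiftInterval a := by
  rintro s ⟨⟨h1, h2⟩, h3, h4⟩
  exact ⟨⟨h1, h2⟩, by linarith, by linarith⟩

lemma shiftInterval_eq_empty {h : ℝ} (hh : 1 ≤ |h|) : shiftInterval h = ∅ := by
  ext s
  simp only [mem_empty_iff_false, iff_false]
  rintro ⟨⟨h1, h2⟩, h3, h4⟩
  rcases le_abs.1 hh with h | h <;> linarith

/-- The `L^p` norm over `I(h)` of the increment `f (· + h) - f`. -/
noncomputable def incrNorm (p : ℝ≥0∞) (f : ℝ → ℝ) (h : ℝ) : ℝ≥0∞ :=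
  eLpNorm (fun s => f (s + h) - f s) p (volume.restrict (shiftInterval h))

lemma measurePreserving_add_restrict (a : ℝ) {S : Set ℝ} (hS : MeasurableSet S) :
    MeasurePreserving (fun s => s + a) (volume.restrict ((fun s => s + a) ⁻¹' S))
      (volume.restrict S) :=
  (measurePreserving_add_right volume a).restrict_preimage hS

lemma aestronglyMeasurable_shift {f : ℝ → ℝ}
    (hf : AEStronglyMeasurable f (volume.restrict (Ioo (0 : ℝ) 1))) (a : ℝ) {S : Set ℝ}
    (hS : ∀ s ∈ S, s + a ∈ Ioo (0 : ℝ) 1) :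
    AEStronglyMeasurable (fun s => f (s + a)) (volume.restrict S) :=
  (hf.comp_measurePreserving (measurePreserving_add_restrict a measurableSet_Ioo)).mono_measure
    (Measure.restrict_mono hS le_rfl)

lemma aestronglyMeasurable_incr {f : ℝ → ℝ}
    (hf : AEStronglyMeasurable f (volume.restrict (Ioo (0 : ℝ) 1))) (a : ℝ) {S : Set ℝ}
    (hS : S ⊆ shiftInterval a) :
    AEStronglyMeasurable (fun s => f (s + a) - f s) (volume.restrict S) :=
  (aestronglyMeasurable_shift hf a fun _ hs => (hS hs).2).sub
    (hf.mono_measure (Measure.restrict_mono (fun _ h => (hS h).1) le_rfl))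

lemma incrNorm_zero (p : ℝ≥0∞) (f : ℝ → ℝ) : incrNorm p f 0 = 0 := by
  simp [incrNorm]

/-- The shift by `a + b` is a shift by `a` followed by one by `b`; translation by `a` preserves
measure and carries `I(a + b)` into `I(b)`. -/
lemma incrNorm_add_le {f : ℝ → ℝ}
    (hf : AEStronglyMeasurable f (volume.restrict (Ioo (0 : ℝ) 1))) {p : ℝ≥0∞} (hp : 1 ≤ p)
    {a b : ℝ} (ha : 0 ≤ a) (hb : 0 ≤ b) :
    incrNorm p f (a + b) ≤ incrNorm p f a + incrNorm p f b := by
  have h1 : shiftInterval (a + b) ⊆ shiftInterval a := shiftInterval_anti ha (by linarith)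
  have h2 : shiftInterval (a + b) ⊆ (fun s => s + a) ⁻¹' (shiftInterval b) := by
    intro s hs
    refine ⟨(h1 hs).2, ?_⟩
    have := hs.2
    rwa [← add_assoc] at this
  have m1 := aestronglyMeasurable_incr hf a h1
  have m2 := aestronglyMeasurable_incr hf b (le_refl (shiftInterval b))
  have mp := measurePreserving_add_restrict a (measurableSet_shiftInterval b)
  have m3 := (m2.comp_measurePreserving mp).mono_measure (Measure.restrict_mono h2 le_rfl)
  have e : (fun s => f (s + (a + b)) - f s) =
      (fun s => f (s + a) - f s) + ((fun s => f (s + b) - f s) ∘ fun s => s + a) := by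
    ext s
    simp [add_assoc]
  unfold incrNorm
  rw [e]
  refine (eLpNorm_add_le m1 m3 hp).trans (add_le_add ?_ ?_)
  · exact eLpNorm_mono_measure _ (Measure.restrict_mono h1 le_rfl)
  · refine (eLpNorm_mono_measure _ (Measure.restrict_mono h2 le_rfl)).trans ?_
    rw [eLpNorm_comp_measurePreserving m2 mp]

lemma incrNorm_neg {f : ℝ → ℝ}
    (hf : AEStronglyMeasurable f (volume.restrict (Ioo (0 : ℝ) 1))) (p : ℝ≥0∞) (h : ℝ) :
    incrNorm p f (-h) = incrNorm p f h := by
  have m2 := aestronglyMeasurable_incr hf (-h) (le_refl (shiftInterval (-h)))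
  have mp := measurePreserving_add_restrict h (measurableSet_shiftInterval (-h))
  have e : (fun s => s + h) ⁻¹' shiftInterval (-h) = shiftInterval h := by
    ext s
    simp [shiftInterval, and_comm]
  rw [e] at mp
  unfold incrNorm
  rw [← eLpNorm_comp_measurePreserving m2 mp, ← eLpNorm_neg]
  congr 1
  ext s
  simp

/-- Binary expansion: halving `k` splits off its last bit, so each scale finer than `2 ^ (-m)` costs
at most one increment. The range `k < 2 ^ (i + 1)`, rather than `2 ^ i`, makes room for `k = 2 ^ i`,
that is for the shift `2 ^ (-m)` itself. -/
lemma incrNorm_dyadic_le {f : ℝ → ℝ}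
    (hf : AEStronglyMeasurable f (volume.restrict (Ioo (0 : ℝ) 1))) {p : ℝ≥0∞} (hp : 1 ≤ p)
    {D q : ℝ} (hD : 0 ≤ D) (hq : 0 ≤ q)
    (H : ∀ n : ℕ, incrNorm p f ((1 / 2) ^ n) ≤ ENNReal.ofReal (D * q ^ n)) (m i : ℕ) :
    ∀ k : ℕ, k < 2 ^ (i + 1) → incrNorm p f (k * (1 / 2) ^ (m + i)) ≤
      ENNReal.ofReal (D * ∑ j ∈ Finset.range (i + 1), q ^ (m + j)) := by
  induction i with
  | zero =>
    intro k hk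
    have : k = 0 ∨ k = 1 := by omega
    rcases this with rfl | rfl
    · simp [incrNorm_zero]
    · simpa using H m
  | succ i ih =>
    intro k hk
    have key : incrNorm p f ((k / 2 : ℕ) * (1 / 2) ^ (m + i)) ≤ _ := ih (k / 2) (by omega)
    rw [Finset.sum_range_succ, mul_add, ENNReal.ofReal_add (by positivity) (by positivity)]
    have hk2 : k = 2 * (k / 2) + k % 2 := by omega
    have e : (k : ℝ) * (1 / 2) ^ (m + (i + 1)) =
        (k / 2 : ℕ) * (1 / 2) ^ (m + i) + (k % 2 : ℕ) * (1 / 2) ^ (m + (i + 1)) := by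
      have : (k : ℝ) = 2 * (k / 2 : ℕ) + (k % 2 : ℕ) := by exact_mod_cast hk2
      rw [this, ← add_assoc m i 1, pow_succ]
      ring
    rw [e]
    refine (incrNorm_add_le hf hp (by positivity) (by positivity)).trans (add_le_add key ?_)
    have : k % 2 = 0 ∨ k % 2 = 1 := by omega
    rcases this with h | h <;> rw [h]
    · simp [incrNorm_zero]
    · simpa using H (m + (i + 1))

/-- Translation is continuous in `L^1`, and convergence in `L^1` gives convergence almost everywhere
along a subsequence. No continuity of paths is needed. -/
lemma exists_seq_tendsto_translate {F : ℝ → ℝ} (hF : MemLp F 1 volume) {u : ℕ → ℝ} {h : ℝ}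
    (hu : Tendsto u atTop (𝓝 h)) :
    ∃ ns : ℕ → ℕ, StrictMono ns ∧
      ∀ᵐ s ∂(volume : Measure ℝ), Tendsto (fun n => F (s + u (ns n))) atTop (𝓝 (F (s + h))) := by
  have : Fact ((1 : ℝ≥0∞) ≠ ∞) := ⟨by simp⟩
  have h1 : Tendsto (fun n => DomAddAct.mk (u n) +ᵥ hF.toLp F) atTop
      (𝓝 (DomAddAct.mk h +ᵥ hF.toLp F)) :=
    (DomAddAct.continuous_mk.tendsto h |>.comp hu).vadd_const _
  obtain ⟨ns, hns, hae⟩ := (tendstoInMeasure_of_tendsto_Lp h1).exists_seq_tendsto_ae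
  refine ⟨ns, hns, ?_⟩
  have e (a : ℝ) : ∀ᵐ s, (DomAddAct.mk a +ᵥ hF.toLp F) s = F (s + a) := by
    rw [DomAddAct.mk_vadd_toLp]
    filter_upwards [MemLp.coeFn_toLp
      (hF.comp_measurePreserving <| measurePreserving_vadd a volume)] with s hs
    refine hs.trans ?_
    simp [vadd_eq_add, add_comm]
  filter_upwards [hae, e h, ae_all_iff.2 fun n => e (u (ns n))] with s h1 h2 h3
  simpa only [h2, h3] using h1

/-- Fatou's lemma along the subsequence. Approximating `h` from below keeps `I(h)` inside every `I(u
n)`, and on `I(h)` the extension of `f` by zero is invisible. -/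
lemma incrNorm_le_of_tendsto {f : ℝ → ℝ} (hf : MemLp f 1 (volume.restrict (Ioo (0 : ℝ) 1)))
    {p C : ℝ≥0∞} {u : ℕ → ℝ} {h : ℝ} (hu : Tendsto u atTop (𝓝 h)) (hu0 : ∀ n, 0 ≤ u n)
    (huh : ∀ n, u n ≤ h) (hC : ∀ n, incrNorm p f (u n) ≤ C) : incrNorm p f h ≤ C := by
  have hF : MemLp ((Ioo (0 : ℝ) 1).indicator f) 1 volume :=
    (memLp_indicator_iff_restrict measurableSet_Ioo).2 hf
  obtain ⟨ns, -, hae⟩ := exists_seq_tendsto_translate hF hu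
  have hsub (n : ℕ) : shiftInterval h ⊆ shiftInterval (u n) := shiftInterval_anti (hu0 n) (huh n)
  unfold incrNorm
  refine (Lp.eLpNorm_lim_le_liminf_eLpNorm (f := fun n s => f (s + u (ns n)) - f s)
    (fun n => aestronglyMeasurable_incr hf.1 _ (hsub _)) _ ?_).trans ?_
  · filter_upwards [ae_restrict_of_ae hae, ae_restrict_mem (measurableSet_shiftInterval h)]
      with s h1 h2
    refine Tendsto.sub_const ?_ _
    rw [indicator_of_mem h2.2] at h1
    refine h1.congr fun n => ?_
    rw [indicator_of_mem (hsub _ h2).2]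
  · refine liminf_le_of_frequently_le' (Frequently.of_forall fun n => ?_)
    exact (eLpNorm_mono_measure _ (Measure.restrict_mono (hsub _) le_rfl)).trans (hC (ns n))

lemma incrNorm_le_of_dyadic {f : ℝ → ℝ} (hf : MemLp f 1 (volume.restrict (Ioo (0 : ℝ) 1)))
    {p : ℝ≥0∞} (hp : 1 ≤ p) {D q : ℝ} (hD : 0 ≤ D) (hq : 0 ≤ q) (hq1 : q < 1)
    (H : ∀ n : ℕ, incrNorm p f ((1 / 2) ^ n) ≤ ENNReal.ofReal (D * q ^ n)) (m : ℕ) {h : ℝ}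
    (h0 : 0 ≤ h) (hm : h ≤ (1 / 2) ^ m) :
    incrNorm p f h ≤ ENNReal.ofReal (D * (q ^ m / (1 - q))) := by
  have hpow : Tendsto (fun i : ℕ => (2 : ℝ) ^ (m + i)) atTop atTop :=
    (tendsto_pow_atTop_atTop_of_one_lt (by norm_num)).comp
      (tendsto_atTop_mono (fun i => Nat.le_add_left i m) tendsto_id)
  have e (i : ℕ) : (1 / 2 : ℝ) ^ (m + i) = ((2 : ℝ) ^ (m + i))⁻¹ := by
    rw [one_div, inv_pow]
  refine incrNorm_le_of_tendsto hf
    (u := fun i => (⌊h * 2 ^ (m + i)⌋₊ : ℝ) * (1 / 2) ^ (m + i)) ?_ (fun i => by positivity) ?_ ?_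
  · have := (tendsto_nat_floor_mul_div_atTop (R := ℝ) h0).comp hpow
    refine this.congr fun i => ?_
    simp only [Function.comp, e]
    rfl
  · intro i
    simp only [e]
    rw [← div_eq_mul_inv, div_le_iff₀ (by positivity)]
    exact Nat.floor_le (by positivity)
  · intro i
    refine (incrNorm_dyadic_le hf.1 hp hD hq H m i _ ?_).trans (ENNReal.ofReal_le_ofReal ?_)
    · rw [Nat.floor_lt (by positivity)]
      calc h * 2 ^ (m + i) ≤ (1 / 2) ^ m * 2 ^ (m + i) := by gcongr
        _ = 2 ^ i := by rw [pow_add, ← mul_assoc, ← mul_pow]; norm_num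
        _ < ((2 ^ (i + 1) : ℕ) : ℝ) := by
          push_cast
          exact pow_lt_pow_right₀ (by norm_num) (by omega)
    · gcongr
      simp only [pow_add, ← Finset.mul_sum]
      rw [div_eq_mul_inv]
      gcongr
      rw [← tsum_geometric_of_lt_one hq hq1]
      exact (summable_geometric_of_lt_one hq hq1).sum_le_tsum _ (fun _ _ => by positivity)

lemma incrNorm_le_rpow_of_dyadic {f : ℝ → ℝ} (hf : MemLp f 1 (volume.restrict (Ioo (0 : ℝ) 1)))
    {p : ℝ≥0∞} (hp : 1 ≤ p) {D α : ℝ} (hD : 0 ≤ D) (hα : 0 < α)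
    (H : ∀ n : ℕ, incrNorm p f ((1 / 2) ^ n) ≤ ENNReal.ofReal (D * ((1 / 2) ^ α) ^ n)) {h : ℝ} :
    incrNorm p f h ≤
      ENNReal.ofReal (D * ((1 / 2) ^ α * (1 - (1 / 2) ^ α))⁻¹ * |h| ^ α) := by
  wlog h0 : 0 ≤ h generalizing h
  · rw [← incrNorm_neg hf.1, ← abs_neg]
    exact this (by linarith)
  have hq0 : (0 : ℝ) < (1 / 2) ^ α := by positivity
  have hq1 : ((1 : ℝ) / 2) ^ α < 1 := Real.rpow_lt_one (by norm_num) (by norm_num) hα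
  rcases h0.eq_or_lt with rfl | h0
  · simp [incrNorm_zero]
  rcases lt_or_ge 1 h with h1 | h1
  · unfold incrNorm
    rw [shiftInterval_eq_empty (h1.le.trans (le_abs_self h))]
    simp
  -- With `2 ^ (-(m + 1)) < h ≤ 2 ^ (-m)`, the factor `q ^ m = q ^ (m + 1) / q` is at most `h ^ α /
  -- q`; this is the origin of the extra `q = (1 / 2) ^ α` in the constant.
  obtain ⟨m, hm1, hm2⟩ := exists_nat_pow_near_of_lt_one h0 h1 (y := (1 / 2 : ℝ))
    (by norm_num) (by norm_num)
  refine (incrNorm_le_of_dyadic hf hp hD hq0.le hq1 H m h0.le hm2).trans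
    (ENNReal.ofReal_le_ofReal ?_)
  rw [mul_assoc]
  gcongr
  rw [mul_inv, abs_of_pos h0, div_eq_mul_inv, mul_right_comm]
  have : 0 < 1 - (1 / 2 : ℝ) ^ α := by linarith
  gcongr
  rw [inv_mul_eq_div, le_div_iff₀ hq0, ← pow_succ, ← Real.rpow_natCast, ← Real.rpow_mul (by norm_num),
    mul_comm, Real.rpow_mul (by norm_num), Real.rpow_natCast]
  exact Real.rpow_le_rpow (by positivity) hm1.le hα.le

lemma expOrliczNorm_two_le {f : ℝ → ℝ} {A : Set ℝ} {C : ℝ}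
    (H : ∀ p : ℝ, 1 ≤ p → eLpNorm f (ENNReal.ofReal p) (volume.restrict A) ≤
      ENNReal.ofReal (C * √p)) : expOrliczNorm 2 f A ≤ ENNReal.ofReal C := by
  refine iSup₂_le fun p hp => ?_
  have hp0 : 0 < p := by linarith
  refine (mul_le_mul_right (H p hp) _).trans ?_
  rw [← ENNReal.ofReal_mul (by positivity)]
  refine ENNReal.ofReal_le_ofReal (le_of_eq ?_)
  rw [Real.rpow_neg hp0.le, ← Real.sqrt_eq_rpow]
  field_simp

/-- Dyadic increments control the Besov-Orlicz norm. -/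
lemma memBesovOrlicz_of_dyadic {f : ℝ → ℝ} {α C D : ℝ} (hα : 0 < α) (hD : 0 ≤ D)
    (hf : AEStronglyMeasurable f (volume.restrict (Ioo (0 : ℝ) 1)))
    (hC : ∀ p : ℝ, 1 ≤ p → eLpNorm f (ENNReal.ofReal p) (volume.restrict (Ioo 0 1)) ≤
      ENNReal.ofReal (C * √p))
    (H : ∀ p : ℝ, 1 ≤ p → ∀ n : ℕ, incrNorm (ENNReal.ofReal p) f ((1 / 2) ^ n) ≤
      ENNReal.ofReal (D * √p * ((1 / 2) ^ α) ^ n)) :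
    MemBesovOrlicz α 2 f := by
  have hf1 : MemLp f 1 (volume.restrict (Ioo (0 : ℝ) 1)) :=
    ⟨hf, by simpa using (hC 1 le_rfl).trans_lt ENNReal.ofReal_lt_top⟩
  refine ⟨hf, ENNReal.add_lt_top.2
    ⟨(expOrliczNorm_two_le hC).trans_lt ENNReal.ofReal_lt_top, ?_⟩⟩
  set κ : ℝ := ((1 / 2) ^ α * (1 - (1 / 2) ^ α))⁻¹
  have hq1 : ((1 : ℝ) / 2) ^ α < 1 := Real.rpow_lt_one (by norm_num) (by norm_num) hα
  have hκ : 0 ≤ κ := inv_nonneg.2 (mul_nonneg (by positivity) (by linarith))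
  refine lt_of_le_of_lt (b := ENNReal.ofReal (D * κ)) (iSup₂_le fun t ht => ?_)
    ENNReal.ofReal_lt_top
  have hm : orliczModulus 2 f t ≤ ENNReal.ofReal (D * κ * t ^ α) := by
    refine iSup₂_le fun h hh => expOrliczNorm_two_le fun p hp => ?_
    refine (incrNorm_le_rpow_of_dyadic hf1 (by simpa using hp) (by positivity) hα
      (H p hp)).trans (ENNReal.ofReal_le_ofReal ?_)
    have : |h| ^ α ≤ t ^ α := Real.rpow_le_rpow (abs_nonneg _) hh hα.le
    calc D * √p * κ * |h| ^ α ≤ D * √p * κ * t ^ α := by gcongr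
      _ = _ := by ring
  refine (mul_le_mul_right hm _).trans ?_
  have ht0 : 0 < t := ht.1
  rw [← ENNReal.ofReal_mul (by positivity)]
  refine ENNReal.ofReal_le_ofReal (le_of_eq ?_)
  rw [Real.rpow_neg ht0.le]
  have : t ^ α ≠ 0 := by positivity
  field_simp

/-! ### Square-exponential integrability and `L^p` norms. -/

/-- `exp (x ^ 2 / 8)` as an extended nonnegative real. -/
noncomputable def expSq (x : ℝ) : ℝ≥0∞ := ENNReal.ofReal (Real.exp (x ^ 2 / 8))

lemma measurable_expSq : Measurable expSq := by
  unfold expSq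
  fun_prop

/-- This is `z ≤ exp (z ^ 2 / 2)` at `z = |x| / (2 σ √p)`, scaled so that the `p`-th power of the
exponential is exactly `expSq (x / σ)`. -/
lemma abs_le_mul_exp_sq {σ p : ℝ} (hσ : 0 < σ) (hp : 0 < p) (x : ℝ) :
    |x| ≤ 2 * σ * √p * Real.exp ((x / σ) ^ 2 / (8 * p)) := by
  set z : ℝ := |x| / (2 * σ * √p) with hz
  have h1 : z ^ 2 / 2 = (x / σ) ^ 2 / (8 * p) := by
    rw [hz, div_pow, mul_pow, Real.sq_sqrt hp.le, sq_abs]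
    field_simp
    norm_num
  have h2 : z ≤ Real.exp (z ^ 2 / 2) := by
    nlinarith [Real.add_one_le_exp (z ^ 2 / 2), sq_nonneg (z - 1)]
  rw [← h1]
  have h3 : |x| = 2 * σ * √p * z := by
    rw [hz]
    field_simp
  rw [h3]
  gcongr

/-- Square-exponential integrability controls all `L^p` norms. -/
lemma eLpNorm_le_of_lintegral_expSq {T : Type*} [MeasurableSpace T] {μ : Measure T} {f : T → ℝ}
    {σ M : ℝ} (hσ : 0 < σ) (hM : 1 ≤ M)
    (h : ∫⁻ t, expSq (f t / σ) ∂μ ≤ ENNReal.ofReal M) {p : ℝ} (hp : 1 ≤ p) :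
    eLpNorm f (ENNReal.ofReal p) μ ≤ ENNReal.ofReal (2 * σ * M * √p) := by
  have hp0 : 0 < p := by linarith
  rw [eLpNorm_eq_lintegral_rpow_enorm_toReal (by simpa using hp0) ENNReal.ofReal_ne_top,
    ENNReal.toReal_ofReal hp0.le, one_div]
  rw [ENNReal.rpow_inv_le_iff hp0]
  have hpt (t : T) : ‖f t‖ₑ ^ p ≤ ENNReal.ofReal ((2 * σ * √p) ^ p) * expSq (f t / σ) := by
    rw [expSq, ← ENNReal.ofReal_mul (by positivity), Real.enorm_eq_ofReal_abs,
      ENNReal.ofReal_rpow_of_nonneg (abs_nonneg _) hp0.le]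
    refine ENNReal.ofReal_le_ofReal ?_
    refine (Real.rpow_le_rpow (abs_nonneg _) (abs_le_mul_exp_sq hσ hp0 (f t)) hp0.le).trans ?_
    rw [Real.mul_rpow (by positivity) (by positivity), ← Real.exp_mul]
    apply le_of_eq
    congr 2
    field_simp
  calc ∫⁻ t, ‖f t‖ₑ ^ p ∂μ
      ≤ ∫⁻ t, ENNReal.ofReal ((2 * σ * √p) ^ p) * expSq (f t / σ) ∂μ := lintegral_mono hpt
    _ = ENNReal.ofReal ((2 * σ * √p) ^ p) * ∫⁻ t, expSq (f t / σ) ∂μ :=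
        lintegral_const_mul' _ _ ENNReal.ofReal_ne_top
    _ ≤ ENNReal.ofReal ((2 * σ * √p) ^ p) * ENNReal.ofReal M := by gcongr
    _ = ENNReal.ofReal ((2 * σ * √p) ^ p * M) := (ENNReal.ofReal_mul (by positivity)).symm
    _ ≤ ENNReal.ofReal (2 * σ * M * √p) ^ p := by
        rw [ENNReal.ofReal_rpow_of_nonneg (by positivity) hp0.le]
        refine ENNReal.ofReal_le_ofReal ?_
        rw [show 2 * σ * M * √p = 2 * σ * √p * M by ring, Real.mul_rpow (x := 2 * σ * √p)
          (y := M) (by positivity) (by positivity)]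
        gcongr
        exact Real.self_le_rpow_of_one_le hM hp

/-! ### Gaussian square-exponential moments and their covariance. -/

lemma lintegral_exp_mul_of_map_eq_gaussianReal {Ω : Type*} [MeasurableSpace Ω] {P : Measure Ω}
    {X : Ω → ℝ} {v : ℝ≥0} (hX : P.map X = gaussianReal 0 v) (t : ℝ) :
    ∫⁻ ω, ENNReal.ofReal (Real.exp (t * X ω)) ∂P = ENNReal.ofReal (Real.exp (v * t ^ 2 / 2)) := by
  have hXm : AEMeasurable X P := aemeasurable_of_map_neZero (by rw [hX]; infer_instance)
  have h := mgf_gaussianReal hX t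
  rw [zero_mul, zero_add] at h
  rw [← h, mgf, ofReal_integral_eq_lintegral_ofReal _ (ae_of_all _ fun _ => (Real.exp_pos _).le)]
  have := integrable_exp_mul_gaussianReal (μ := 0) (v := v) t
  rw [← hX] at this
  exact this.comp_aemeasurable hXm

/-- Linearization of the square in `expSq` by a Gaussian integral. -/
lemma expSq_eq_lintegral (x : ℝ) :
    expSq x = ∫⁻ g, ENNReal.ofReal (Real.exp (x / 2 * g)) ∂gaussianReal 0 1 := by
  have := lintegral_exp_mul_of_map_eq_gaussianReal (X := id) (P := gaussianReal 0 1)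
    Measure.map_id (x / 2)
  simp only [id] at this
  rw [this, expSq]
  congr 2
  push_cast
  ring

/-- The Gaussian moment `E exp (g ^ 2 / 4)`. -/
noncomputable def gaussExpMoment : ℝ≥0∞ :=
  ∫⁻ g, ENNReal.ofReal (Real.exp (g ^ 2 / 4)) ∂gaussianReal 0 1

lemma gaussExpMoment_lt_top : gaussExpMoment < ∞ := by
  unfold gaussExpMoment
  rw [gaussianReal_of_var_ne_zero _ one_ne_zero,
    lintegral_withDensity_eq_lintegral_mul _ (measurable_gaussianPDF 0 1) (by fun_prop)]
  have h : ∀ g : ℝ, (gaussianPDF 0 1 * fun g => ENNReal.ofReal (Real.exp (g ^ 2 / 4))) g =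
      ENNReal.ofReal ((√(2 * Real.pi))⁻¹ * Real.exp (-(1 / 4) * g ^ 2)) := by
    intro g
    rw [Pi.mul_apply, gaussianPDF, gaussianPDFReal, ← ENNReal.ofReal_mul (by positivity),
      mul_assoc, ← Real.exp_add]
    congr 3
    · simp
    · push_cast
      ring
  simp_rw [h]
  exact ((integrable_exp_neg_mul_sq (by norm_num : (0 : ℝ) < 1 / 4)).const_mul _).lintegral_lt_top

/-- Convexity of `exp` between `0` and `|x|`. It moves the correlation `r` out of the exponent,
making the error linear in `|r|`. -/
lemma exp_mul_le_of_abs_le_one {r : ℝ} (hr : |r| ≤ 1) (x : ℝ) :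
    Real.exp (r * x) ≤ 1 + |r| * Real.exp |x| := by
  have h := convexOn_exp.2 (mem_univ 0) (mem_univ |x|) (sub_nonneg.2 hr) (abs_nonneg r)
    (by ring)
  simp only [smul_eq_mul, mul_zero, zero_add, Real.exp_zero, mul_one] at h
  have h2 : Real.exp (r * x) ≤ Real.exp (|r| * |x|) := by
    rw [← abs_mul]
    exact Real.exp_le_exp.2 (le_abs_self _)
  have := abs_nonneg r
  linarith

section Gaussian

variable {Ω : Type*} [MeasurableSpace Ω] {P : Measure Ω} {X Y : Ω → ℝ}

lemma ProbabilityTheory.HasGaussianLaw.map_eq_of_centred [IsProbabilityMeasure P]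
    (hX : HasGaussianLaw X P) (hX0 : ∫ ω, X ω ∂P = 0) :
    P.map X = gaussianReal 0 (∫ ω, X ω ^ 2 ∂P).toNNReal := by
  rw [hX.map_eq_gaussianReal, hX0, variance_of_integral_eq_zero hX.aemeasurable hX0]

/-- After linearization and Tonelli only the Laplace transform of `X` remains. The variance is kept
exact so that the product of two such means matches the main term in `lintegral_expSq_mul_le`. -/
lemma lintegral_expSq [IsProbabilityMeasure P] (hX : HasGaussianLaw X P)
    (hX0 : ∫ ω, X ω ∂P = 0) :
    ∫⁻ ω, expSq (X ω) ∂P =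
      ∫⁻ g, ENNReal.ofReal (Real.exp ((∫ ω, X ω ^ 2 ∂P) * g ^ 2 / 8)) ∂gaussianReal 0 1 := by
  have hXm := hX.aemeasurable
  have hv : 0 ≤ ∫ ω, X ω ^ 2 ∂P := integral_nonneg fun _ => sq_nonneg _
  simp_rw [expSq_eq_lintegral]
  rw [lintegral_lintegral_swap]
  · refine lintegral_congr fun g => ?_
    have := lintegral_exp_mul_of_map_eq_gaussianReal (hX.map_eq_of_centred hX0) (g / 2)
    rw [Real.coe_toNNReal _ hv] at this
    calc _ = ∫⁻ ω, ENNReal.ofReal (Real.exp (g / 2 * X ω)) ∂P :=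
          lintegral_congr fun ω => by ring_nf
      _ = _ := by rw [this]; ring_nf
  · have h1 : AEMeasurable (fun z : Ω × ℝ => X z.1) (P.prod (gaussianReal 0 1)) :=
      hXm.comp_fst
    have h2 : AEMeasurable (fun z : Ω × ℝ => z.2) (P.prod (gaussianReal 0 1)) :=
      measurable_snd.aemeasurable
    exact (((h1.div_const 2).mul h2).exp).ennreal_ofReal

lemma lintegral_expSq_le [IsProbabilityMeasure P] (hX : HasGaussianLaw X P)
    (hX0 : ∫ ω, X ω ∂P = 0) (hX1 : ∫ ω, X ω ^ 2 ∂P ≤ 1) :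
    ∫⁻ ω, expSq (X ω) ∂P ≤ gaussExpMoment := by
  rw [lintegral_expSq hX hX0]
  refine lintegral_mono fun g => ENNReal.ofReal_le_ofReal (Real.exp_le_exp.2 ?_)
  nlinarith [sq_nonneg g]

lemma integral_sq_linear_comb (hX : MemLp X 2 P) (hY : MemLp Y 2 P) (a b : ℝ) :
    ∫ ω, (a * X ω + b * Y ω) ^ 2 ∂P =
      a ^ 2 * ∫ ω, X ω ^ 2 ∂P + 2 * a * b * ∫ ω, X ω * Y ω ∂P + b ^ 2 * ∫ ω, Y ω ^ 2 ∂P := by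
  have i1 := hX.integrable_sq
  have i2 := hY.integrable_sq
  have i3 : Integrable (fun ω => X ω * Y ω) P := hX.integrable_mul hY
  rw [← integral_const_mul, ← integral_const_mul, ← integral_const_mul, ← integral_add
    (i1.const_mul _) (i3.const_mul _), ← integral_add
    (f := fun ω => a ^ 2 * X ω ^ 2 + 2 * a * b * (X ω * Y ω))
    ((i1.const_mul _).add (i3.const_mul _)) (i2.const_mul _)]
  congr 1
  ext ω
  ring

lemma abs_integral_mul_le_one (hX : MemLp X 2 P) (hY : MemLp Y 2 P)
    (hX1 : ∫ ω, X ω ^ 2 ∂P ≤ 1) (hY1 : ∫ ω, Y ω ^ 2 ∂P ≤ 1) : |∫ ω, X ω * Y ω ∂P| ≤ 1 := by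
  have h1 := integral_sq_linear_comb hX hY 1 1
  have h2 := integral_sq_linear_comb hX hY 1 (-1)
  have h3 : 0 ≤ ∫ ω, (1 * X ω + 1 * Y ω) ^ 2 ∂P := integral_nonneg fun _ => sq_nonneg _
  have h4 : 0 ≤ ∫ ω, (1 * X ω + -1 * Y ω) ^ 2 ∂P := integral_nonneg fun _ => sq_nonneg _
  rw [abs_le]
  constructor <;> linarith

/-- The covariance of `exp (X ^ 2 / 8)` and `exp (Y ^ 2 / 8)` is controlled by that of `X`
and `Y`. -/
lemma lintegral_expSq_mul_le [IsProbabilityMeasure P]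
    (hXY : HasGaussianLaw (fun ω => (X ω, Y ω)) P)
    (hX0 : ∫ ω, X ω ∂P = 0) (hY0 : ∫ ω, Y ω ∂P = 0)
    (hX1 : ∫ ω, X ω ^ 2 ∂P ≤ 1) (hY1 : ∫ ω, Y ω ^ 2 ∂P ≤ 1) :
    ∫⁻ ω, expSq (X ω) * expSq (Y ω) ∂P ≤
      (∫⁻ ω, expSq (X ω) ∂P) * (∫⁻ ω, expSq (Y ω) ∂P) +
        ENNReal.ofReal |∫ ω, X ω * Y ω ∂P| * gaussExpMoment ^ 2 := by
  have hX := hXY.fst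
  have hY := hXY.snd
  have hXm := hX.aemeasurable
  have hYm := hY.aemeasurable
  set a := ∫ ω, X ω ^ 2 ∂P with ha
  set b := ∫ ω, Y ω ^ 2 ∂P with hb
  set r := ∫ ω, X ω * Y ω ∂P with hr
  have hr1 : |r| ≤ 1 := abs_integral_mul_le_one hX.memLp_two hY.memLp_two hX1 hY1
  let γ := gaussianReal 0 1
  let E : ℝ × ℝ → ℝ≥0∞ := fun z =>
    ENNReal.ofReal (Real.exp ((z.1 ^ 2 * a + 2 * z.1 * z.2 * r + z.2 ^ 2 * b) / 8))
  have key : ∫⁻ ω, expSq (X ω) * expSq (Y ω) ∂P = ∫⁻ z, E z ∂(γ.prod γ) := by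
    have e1 (ω : Ω) : expSq (X ω) * expSq (Y ω) =
        ∫⁻ z, ENNReal.ofReal (Real.exp ((z.1 * X ω + z.2 * Y ω) / 2)) ∂(γ.prod γ) := by
      rw [expSq_eq_lintegral, expSq_eq_lintegral, ← lintegral_prod_mul (by fun_prop)
        (by fun_prop)]
      refine lintegral_congr fun z => ?_
      rw [← ENNReal.ofReal_mul (by positivity), ← Real.exp_add]
      ring_nf
    simp_rw [e1]
    rw [lintegral_lintegral_swap]
    · refine lintegral_congr fun z => ?_
      have hg : HasGaussianLaw (fun ω => z.1 * X ω + z.2 * Y ω) P :=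
        hXY.map_fun (z.1 • ContinuousLinearMap.fst ℝ ℝ ℝ + z.2 • ContinuousLinearMap.snd ℝ ℝ ℝ)
      have hg0 : ∫ ω, (z.1 * X ω + z.2 * Y ω) ∂P = 0 := by
        rw [integral_add (hX.integrable.const_mul _) (hY.integrable.const_mul _),
          integral_const_mul, integral_const_mul, hX0, hY0]
        simp
      have hv : 0 ≤ ∫ ω, (z.1 * X ω + z.2 * Y ω) ^ 2 ∂P := integral_nonneg fun _ => sq_nonneg _
      have := lintegral_exp_mul_of_map_eq_gaussianReal (hg.map_eq_of_centred hg0) (1 / 2)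
      rw [Real.coe_toNNReal _ hv, integral_sq_linear_comb hX.memLp_two hY.memLp_two] at this
      calc _ = ∫⁻ ω, ENNReal.ofReal (Real.exp (1 / 2 * (z.1 * X ω + z.2 * Y ω))) ∂P :=
            lintegral_congr fun ω => by ring_nf
        _ = _ := by rw [this]; simp only [E, ha, hb, hr]; ring_nf
    · have h1 : AEMeasurable (fun z : Ω × ℝ × ℝ => X z.1) (P.prod (γ.prod γ)) := hXm.comp_fst
      have h2 : AEMeasurable (fun z : Ω × ℝ × ℝ => Y z.1) (P.prod (γ.prod γ)) := hYm.comp_fst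
      have h3 : AEMeasurable (fun z : Ω × ℝ × ℝ => z.2.1) (P.prod (γ.prod γ)) := by fun_prop
      have h4 : AEMeasurable (fun z : Ω × ℝ × ℝ => z.2.2) (P.prod (γ.prod γ)) := by fun_prop
      exact ((((h3.mul h1).add (h4.mul h2)).div_const 2).exp).ennreal_ofReal
  -- Only the cross term `r x y / 4` couples the variables. Its error is dominated through `|x y| /
  -- 4 ≤ (x ^ 2 + y ^ 2) / 8` and `a, b ≤ 1`, leaving `exp (x ^ 2 / 4) exp (y ^ 2 / 4)`, which is
  -- still Gaussian integrable.
  have bound (z : ℝ × ℝ) : E z ≤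
      ENNReal.ofReal (Real.exp (a * z.1 ^ 2 / 8)) * ENNReal.ofReal (Real.exp (b * z.2 ^ 2 / 8)) +
      ENNReal.ofReal |r| *
        (ENNReal.ofReal (Real.exp (z.1 ^ 2 / 4)) * ENNReal.ofReal (Real.exp (z.2 ^ 2 / 4))) := by
    simp only [E]
    rw [← ENNReal.ofReal_mul (by positivity), ← ENNReal.ofReal_mul (by positivity),
      ← ENNReal.ofReal_mul (by positivity), ← ENNReal.ofReal_add (by positivity) (by positivity)]
    refine ENNReal.ofReal_le_ofReal ?_
    obtain ⟨x, y⟩ := z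
    have h1 := exp_mul_le_of_abs_le_one hr1 (x * y / 4)
    have h2 : Real.exp (a * x ^ 2 / 8) * Real.exp (b * y ^ 2 / 8) * Real.exp |x * y / 4| ≤
        Real.exp (x ^ 2 / 4) * Real.exp (y ^ 2 / 4) := by
      rw [← Real.exp_add, ← Real.exp_add, ← Real.exp_add]
      refine Real.exp_le_exp.2 ?_
      have : |x * y / 4| ≤ (x ^ 2 + y ^ 2) / 8 := by
        rw [abs_le]
        constructor <;> nlinarith [sq_nonneg (x - y), sq_nonneg (x + y)]
      nlinarith [sq_nonneg x, sq_nonneg y]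
    calc Real.exp ((x ^ 2 * a + 2 * x * y * r + y ^ 2 * b) / 8)
        = Real.exp (a * x ^ 2 / 8) * Real.exp (b * y ^ 2 / 8) * Real.exp (r * (x * y / 4)) := by
          rw [← Real.exp_add, ← Real.exp_add]
          ring_nf
      _ ≤ Real.exp (a * x ^ 2 / 8) * Real.exp (b * y ^ 2 / 8) *
            (1 + |r| * Real.exp |x * y / 4|) := by gcongr
      _ = Real.exp (a * x ^ 2 / 8) * Real.exp (b * y ^ 2 / 8) + |r| *
            (Real.exp (a * x ^ 2 / 8) * Real.exp (b * y ^ 2 / 8) * Real.exp |x * y / 4|) := by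
          ring
      _ ≤ _ := by gcongr
  rw [key, lintegral_expSq hX hX0, lintegral_expSq hY hY0]
  refine (lintegral_mono bound).trans (le_of_eq ?_)
  rw [lintegral_add_left (by fun_prop), lintegral_const_mul _ (by fun_prop),
    lintegral_prod_mul (f := fun g => ENNReal.ofReal (Real.exp (a * g ^ 2 / 8)))
      (g := fun g => ENNReal.ofReal (Real.exp (b * g ^ 2 / 8))) (by fun_prop) (by fun_prop),
    lintegral_prod_mul (f := fun g => ENNReal.ofReal (Real.exp (g ^ 2 / 4)))
      (g := fun g => ENNReal.ofReal (Real.exp (g ^ 2 / 4))) (by fun_prop) (by fun_prop), sq]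
  rfl

end Gaussian

/-! ### Variance of the increments. -/

lemma bifractionalCov_comm (H K : ℝ) (t s : ℝ≥0) :
    bifractionalCov H K t s = bifractionalCov H K s t := by
  unfold bifractionalCov
  rw [add_comm, abs_sub_comm]

lemma two_rpow_neg_mul_add_self_rpow {H K : ℝ} (t : ℝ) (ht : 0 ≤ t) :
    (2 : ℝ) ^ (-K) * (t ^ (2 * H) + t ^ (2 * H)) ^ K = t ^ (2 * H * K) := by
  rw [← two_mul, Real.mul_rpow (by norm_num) (by positivity), ← Real.rpow_mul ht, ← mul_assoc,
    ← Real.rpow_add (by norm_num)]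
  simp

lemma bifractionalCov_self {H K : ℝ} (hHK : 0 < H * K) (t : ℝ≥0) :
    bifractionalCov H K t t = (t : ℝ) ^ (2 * H * K) := by
  unfold bifractionalCov
  rw [sub_self, abs_zero, Real.zero_rpow (by linarith), sub_zero,
    two_rpow_neg_mul_add_self_rpow _ t.coe_nonneg]

/-- The left side vanishes to second order at `u = 1`, so Taylor's formula gives `C (u - 1) ^ 2` on
`[1, 2]`, and `2HK ≤ 2` lowers the exponent. For `u ≥ 2` the subtracted term is dropped and `u ≤ 2
(u - 1)` suffices. -/
lemma exists_rpow_add_one_sub_le {H K : ℝ} (hHK0 : 0 < H * K) (hHK1 : H * K < 1) :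
    ∃ C : ℝ, 0 ≤ C ∧ ∀ u : ℝ, 1 ≤ u →
      u ^ (2 * H * K) + 1 - 2 * (2 ^ (-K) * (u ^ (2 * H) + 1) ^ K) ≤
        C * (u - 1) ^ (2 * H * K) := by
  set φ : ℝ → ℝ := fun u => u ^ (2 * H * K) + 1 - 2 * (2 ^ (-K) * (u ^ (2 * H) + 1) ^ K) with hφ
  have hcd : ContDiffOn ℝ (1 + 1) φ (Icc 1 2) := by
    have h0 : ∀ x ∈ Icc (1 : ℝ) 2, x ≠ 0 := fun x hx => by linarith [hx.1]
    have h1 (e : ℝ) : ContDiffOn ℝ (1 + 1) (fun u : ℝ => u ^ e) (Icc 1 2) :=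
      contDiffOn_id.rpow_const_of_ne h0
    have h2 : ContDiffOn ℝ (1 + 1) (fun u : ℝ => (u ^ (2 * H) + 1) ^ K) (Icc 1 2) := by
      refine ((h1 _).add contDiffOn_const).rpow_const_of_ne fun x hx => ?_
      have : 0 < x := by linarith [hx.1]
      positivity
    exact ((h1 _).add contDiffOn_const).sub (contDiffOn_const.mul (contDiffOn_const.mul h2))
  have hφ1 : φ 1 = 0 := by
    have := two_rpow_neg_mul_add_self_rpow (H := H) (K := K) 1 zero_le_one
    simp only [Real.one_rpow] at this
    simp only [hφ, Real.one_rpow, this]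
    norm_num
  have hd : HasDerivAt φ 0 1 := by
    have h1 (e : ℝ) : HasDerivAt (fun u : ℝ => u ^ e) e 1 := by
      simpa using Real.hasDerivAt_rpow_const (x := 1) (p := e) (Or.inl one_ne_zero)
    have h2 := ((h1 (2 * H)).add_const 1).rpow_const (p := K) (Or.inl (by simp))
    have h3 := ((h1 (2 * H * K)).add_const 1).sub ((h2.const_mul (2 ^ (-K))).const_mul 2)
    refine h3.congr_deriv ?_
    rw [Real.one_rpow, Real.rpow_sub_one (by norm_num), one_add_one_eq_two, Real.rpow_neg two_pos.le]
    have : (2 : ℝ) ^ K ≠ 0 := by positivity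
    field_simp
    ring
  obtain ⟨C, hC⟩ := exists_taylor_mean_remainder_bound (n := 1) one_le_two hcd
  have hT (u : ℝ) : taylorWithinEval φ 1 (Icc 1 2) 1 u = 0 := by
    rw [taylorWithinEval_succ, taylor_within_zero_eval, hφ1, iteratedDerivWithin_one,
      hd.hasDerivWithinAt.derivWithin (uniqueDiffOn_Icc one_lt_two 1 (by simp))]
    simp
  refine ⟨max C (2 * 2 ^ (2 * H * K)), le_max_of_le_right (by positivity), fun u hu => ?_⟩
  have hu0 : 0 ≤ u - 1 := by linarith
  rcases le_total u 2 with hu2 | hu2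
  · have h1 := hC u ⟨hu, hu2⟩
    rw [hT, sub_zero] at h1
    calc φ u ≤ C * (u - 1) ^ 2 := (le_abs_self _).trans h1
      _ ≤ max C (2 * 2 ^ (2 * H * K)) * (u - 1) ^ 2 := by gcongr; exact le_max_left _ _
      _ ≤ _ := by
        gcongr
        rcases hu0.eq_or_lt with h | h
        · rw [← h, Real.zero_rpow (by linarith)]
          norm_num
        · rw [← Real.rpow_natCast]
          exact Real.rpow_le_rpow_of_exponent_ge h (by linarith) (by push_cast; linarith)
  · have h2 : u ^ (2 * H * K) ≤ 2 ^ (2 * H * K) * (u - 1) ^ (2 * H * K) := by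
      rw [← Real.mul_rpow (by norm_num) hu0]
      exact Real.rpow_le_rpow (by linarith) (by linarith) (by linarith)
    have h3 : 1 ≤ u ^ (2 * H * K) := Real.one_le_rpow hu (by linarith)
    have h4 : 0 ≤ 2 ^ (-K) * (u ^ (2 * H) + 1) ^ K := by positivity
    calc φ u ≤ 2 * 2 ^ (2 * H * K) * (u - 1) ^ (2 * H * K) := by simp only [hφ]; linarith
      _ ≤ _ := by gcongr; exact le_max_right _ _

/-- The variance of increments of bifractional Brownian motion. -/
lemma exists_bifractionalCov_incr_le {H K : ℝ} (hHK0 : 0 < H * K) (hHK1 : H * K < 1) :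
    ∃ V : ℝ, 1 ≤ V ∧ ∀ t s : ℝ≥0, 0 < s → s ≤ t →
      bifractionalCov H K t t + bifractionalCov H K s s - 2 * bifractionalCov H K t s ≤
        V * ((t : ℝ) - s) ^ (2 * H * K) := by
  obtain ⟨C, hC0, hC⟩ := exists_rpow_add_one_sub_le hHK0 hHK1
  -- By homogeneity, `u = t / s` handles all but the `|t - s|` part of the covariance. That part
  -- contributes `2 * 2 ^ (-K)`, and the final `1` ensures `V ≥ 1`.
  refine ⟨C + 2 * 2 ^ (-K) + 1, by linarith [show (0 : ℝ) < 2 ^ (-K) by positivity],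
    fun t s hs hst => ?_⟩
  rw [bifractionalCov_self hHK0, bifractionalCov_self hHK0, bifractionalCov]
  have hs' : (0 : ℝ) < s := hs
  have hst' : (s : ℝ) ≤ t := hst
  have ht' : (0 : ℝ) < t := hs'.trans_le hst'
  have hu : 1 ≤ (t : ℝ) / s := (one_le_div hs').2 hst'
  have h1 := mul_le_mul_of_nonneg_left (hC _ hu) (Real.rpow_nonneg hs'.le (2 * H * K))
  have e1 : (s : ℝ) ^ (2 * H * K) * ((t : ℝ) / s) ^ (2 * H * K) = (t : ℝ) ^ (2 * H * K) := by
    rw [← Real.mul_rpow hs'.le (by positivity), mul_div_cancel₀ _ hs'.ne']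
  have e2 : (s : ℝ) ^ (2 * H * K) * (((t : ℝ) / s) ^ (2 * H) + 1) ^ K =
      ((t : ℝ) ^ (2 * H) + (s : ℝ) ^ (2 * H)) ^ K := by
    rw [Real.rpow_mul hs'.le, ← Real.mul_rpow (by positivity) (by positivity), mul_add, mul_one,
      ← Real.mul_rpow hs'.le (by positivity), mul_div_cancel₀ _ hs'.ne']
  have e3 : (s : ℝ) ^ (2 * H * K) * ((t : ℝ) / s - 1) ^ (2 * H * K) =
      ((t : ℝ) - s) ^ (2 * H * K) := by
    rw [← Real.mul_rpow hs'.le (by linarith), mul_sub, mul_div_cancel₀ _ hs'.ne', mul_one]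
  have hx : 0 ≤ ((t : ℝ) - s) ^ (2 * H * K) := Real.rpow_nonneg (by linarith) _
  rw [abs_of_nonneg (by linarith : (0 : ℝ) ≤ t - s)]
  have h2 : (t : ℝ) ^ (2 * H * K) + (s : ℝ) ^ (2 * H * K) -
      2 * (2 ^ (-K) * ((t : ℝ) ^ (2 * H) + (s : ℝ) ^ (2 * H)) ^ K) ≤
      C * ((t : ℝ) - s) ^ (2 * H * K) := by
    rw [← e2, ← e3, ← e1]
    linarith
  linarith

/-! ### Covariance of increments over separated intervals. -/

/-- A mixed second difference is bounded by the mixed second derivative. -/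
lemma abs_mixed_difference_le {F Fx Fxy : ℝ → ℝ → ℝ} {t s h M : ℝ} (hh : 0 ≤ h)
    (h1 : ∀ x ∈ Icc t (t + h), ∀ y ∈ Icc s (s + h), HasDerivAt (fun x => F x y) (Fx x y) x)
    (h2 : ∀ x ∈ Icc t (t + h), ∀ y ∈ Icc s (s + h), HasDerivAt (fun y => Fx x y) (Fxy x y) y)
    (hM : ∀ x ∈ Icc t (t + h), ∀ y ∈ Icc s (s + h), |Fxy x y| ≤ M) :
    |F (t + h) (s + h) - F (t + h) s - F t (s + h) + F t s| ≤ M * h ^ 2 := by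
  have ms : s ∈ Icc s (s + h) := ⟨le_rfl, by linarith⟩
  have ms' : s + h ∈ Icc s (s + h) := ⟨by linarith, le_rfl⟩
  have mt : t ∈ Icc t (t + h) := ⟨le_rfl, by linarith⟩
  have mt' : t + h ∈ Icc t (t + h) := ⟨by linarith, le_rfl⟩
  have inner (x : ℝ) (hx : x ∈ Icc t (t + h)) : ‖Fx x (s + h) - Fx x s‖ ≤ M * h := by
    have := (convex_Icc s (s + h)).norm_image_sub_le_of_norm_hasDerivWithin_le
      (f := fun y => Fx x y) (fun y hy => (h2 x hx y hy).hasDerivWithinAt) (hM x hx) ms ms'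
    simpa [abs_of_nonneg hh] using this
  have := (convex_Icc t (t + h)).norm_image_sub_le_of_norm_hasDerivWithin_le
    (f := fun x => F x (s + h) - F x s)
    (fun x hx => ((h1 x hx _ ms').sub (h1 x hx _ ms)).hasDerivWithinAt) inner mt mt'
  simp only [add_sub_cancel_left, Real.norm_eq_abs, abs_of_nonneg hh] at this
  calc _ = |F (t + h) (s + h) - F (t + h) s - (F t (s + h) - F t s)| := by ring_nf
    _ ≤ M * h * h := this
    _ = M * h ^ 2 := by ring

lemma rpow_le_inv_pow {d x e : ℝ} (n : ℕ) (hd : 0 < d) (hdx : d ≤ x) (hx : x ≤ 1)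
    (he : -(n : ℝ) ≤ e) : x ^ e ≤ (d ^ n)⁻¹ := by
  have hx0 : 0 < x := hd.trans_le hdx
  calc x ^ e ≤ x ^ (-(n : ℝ)) := Real.rpow_le_rpow_of_exponent_ge hx0 hx he
    _ = (x ^ n)⁻¹ := by rw [Real.rpow_neg hx0.le, Real.rpow_natCast]
    _ ≤ (d ^ n)⁻¹ := by gcongr

lemma abs_mixed_difference_rpow_sub_le {a d t s h : ℝ} (ha0 : 0 < a) (ha2 : a < 2) (hd : 0 < d)
    (hh : 0 ≤ h) (ht : 0 ≤ t) (hs : s + h ≤ 1) (hts : t + h + d ≤ s) :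
    |(s + h - (t + h)) ^ a - (s - (t + h)) ^ a - (s + h - t) ^ a + (s - t) ^ a| ≤
      2 * (d ^ 2)⁻¹ * h ^ 2 := by
  refine abs_mixed_difference_le (F := fun x y => (y - x) ^ a)
    (Fx := fun x y => -1 * a * (y - x) ^ (a - 1))
    (Fxy := fun x y => -1 * a * (1 * (a - 1) * (y - x) ^ (a - 1 - 1))) hh ?_ ?_ ?_
  · intro x hx y hy
    have : 0 < y - x := by linarith [hx.2, hy.1]
    exact ((hasDerivAt_id x).const_sub y).rpow_const (Or.inl this.ne')
  · intro x hx y hy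
    have : 0 < y - x := by linarith [hx.2, hy.1]
    exact (((hasDerivAt_id y).sub_const x).rpow_const (Or.inl this.ne')).const_mul _
  · intro x hx y hy
    have h1 : d ≤ y - x := by linarith [hx.2, hy.1]
    have h2 := rpow_le_inv_pow (e := a - 1 - 1) 2 hd h1 (by linarith [hx.1, hy.2])
      (by push_cast; linarith)
    have h3 : 0 ≤ (y - x) ^ (a - 1 - 1) := Real.rpow_nonneg (by linarith) _
    have h4 : |a - 1| ≤ 1 := by rw [abs_le]; constructor <;> linarith
    simp only [abs_mul, abs_neg, abs_one, one_mul, abs_of_pos ha0, abs_of_nonneg h3]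
    calc a * (|a - 1| * (y - x) ^ (a - 1 - 1)) ≤ 2 * (1 * (d ^ 2)⁻¹) := by gcongr
      _ = _ := by ring

/-- In the mixed derivative `x ^ (a - 1)` and `y ^ (a - 1)` cost `d ^ (-1)` each. Since `x ^ a + y ^
a ≥ d ^ 2`, its power `K - 2` costs at most `d ^ (-4)`; the coefficients are at most `2 * 2 * 2 *
1`. -/
lemma abs_mixed_difference_add_rpow_le {a K d t s h : ℝ} (ha0 : 0 < a) (ha2 : a < 2)
    (hK0 : 0 < K) (hK2 : K ≤ 2) (hd : 0 < d) (hd1 : d ≤ 1) (hh : 0 ≤ h) (ht : d ≤ t) (hs : d ≤ s)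
    (ht1 : t + h ≤ 1) (hs1 : s + h ≤ 1) :
    |((t + h) ^ a + (s + h) ^ a) ^ K - ((t + h) ^ a + s ^ a) ^ K - (t ^ a + (s + h) ^ a) ^ K +
      (t ^ a + s ^ a) ^ K| ≤ 8 * (d ^ 6)⁻¹ * h ^ 2 := by
  refine abs_mixed_difference_le (F := fun x y => (x ^ a + y ^ a) ^ K)
    (Fx := fun x y => a * x ^ (a - 1) * K * (x ^ a + y ^ a) ^ (K - 1))
    (Fxy := fun x y => a * x ^ (a - 1) * K *
      (a * y ^ (a - 1) * (K - 1) * (x ^ a + y ^ a) ^ (K - 1 - 1))) hh ?_ ?_ ?_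
  · intro x hx y hy
    have hx0 : 0 < x := by linarith [hx.1]
    have hy0 : 0 < y := by linarith [hy.1]
    have : 0 < x ^ a + y ^ a := by positivity
    exact ((Real.hasDerivAt_rpow_const (Or.inl hx0.ne')).add_const _).rpow_const
      (Or.inl this.ne')
  · intro x hx y hy
    have hx0 : 0 < x := by linarith [hx.1]
    have hy0 : 0 < y := by linarith [hy.1]
    have : 0 < x ^ a + y ^ a := by positivity
    exact (((Real.hasDerivAt_rpow_const (Or.inl hy0.ne')).const_add _).rpow_const
      (Or.inl this.ne')).const_mul _
  · intro x hx y hy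
    have hx0 : 0 < x := by linarith [hx.1]
    have hy0 : 0 < y := by linarith [hy.1]
    have hxd : d ≤ x := ht.trans hx.1
    have hyd : d ≤ y := hs.trans hy.1
    have h1 := rpow_le_inv_pow (e := a - 1) 1 hd hxd (hx.2.trans ht1) (by push_cast; linarith)
    have h2 := rpow_le_inv_pow (e := a - 1) 1 hd hyd (hy.2.trans hs1) (by push_cast; linarith)
    have h3 : d ^ 2 ≤ x ^ a + y ^ a := by
      have h4 : x ^ (2 : ℝ) ≤ x ^ a :=
        Real.rpow_le_rpow_of_exponent_ge hx0 (hx.2.trans ht1) ha2.le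
      have h5 : d ^ 2 ≤ x ^ 2 := by gcongr
      rw [Real.rpow_two] at h4
      linarith [Real.rpow_pos_of_pos hy0 a]
    have h4 : (x ^ a + y ^ a) ^ (K - 1 - 1) ≤ (d ^ 4)⁻¹ := by
      calc (x ^ a + y ^ a) ^ (K - 1 - 1) ≤ (d ^ 2) ^ (K - 1 - 1) :=
            Real.rpow_le_rpow_of_nonpos (by positivity) h3 (by linarith)
        _ ≤ ((d ^ 2) ^ 2)⁻¹ :=
            rpow_le_inv_pow 2 (by positivity) le_rfl (pow_le_one₀ hd.le hd1) (by push_cast; linarith)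
        _ = _ := by ring
    have h5 : |K - 1| ≤ 1 := by rw [abs_le]; constructor <;> linarith
    have p1 : 0 < x ^ (a - 1) := by positivity
    have p2 : 0 < y ^ (a - 1) := by positivity
    have p3 : 0 < (x ^ a + y ^ a) ^ (K - 1 - 1) := by positivity
    rw [abs_mul, abs_mul, abs_mul, abs_mul, abs_mul, abs_mul, abs_of_pos ha0, abs_of_pos hK0,
      abs_of_pos p1, abs_of_pos p2, abs_of_pos p3]
    calc a * x ^ (a - 1) * K * (a * y ^ (a - 1) * |K - 1| * (x ^ a + y ^ a) ^ (K - 1 - 1))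
        ≤ 2 * (d ^ 1)⁻¹ * 2 * (2 * (d ^ 1)⁻¹ * 1 * (d ^ 4)⁻¹) := by gcongr
      _ = 8 * (d ^ 6)⁻¹ := by
        field_simp
        norm_num

/-- The covariance of increments of bifractional Brownian motion over separated intervals. -/
lemma abs_bifractionalCov_incr_le {H K : ℝ} (hH0 : 0 < H) (hH1 : H < 1) (hK0 : 0 < K)
    (hK2 : K ≤ 2) (hHK1 : H * K < 1) {d : ℝ} {t s h : ℝ≥0} (hd : 0 < d) (hd1 : d ≤ 1)
    (hhd : (h : ℝ) ≤ d) (ht : d ≤ t) (hs : d ≤ s) (ht1 : (t : ℝ) + h ≤ 1)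
    (hs1 : (s : ℝ) + h ≤ 1) (hts : 2 * d ≤ |(t : ℝ) - s|) :
    |bifractionalCov H K (t + h) (s + h) - bifractionalCov H K (t + h) s -
      bifractionalCov H K t (s + h) + bifractionalCov H K t s| ≤ 10 * (d ^ 6)⁻¹ * (h : ℝ) ^ 2 := by
  wlog hle : t ≤ s generalizing t s
  · have := this hs ht hs1 ht1 (by rwa [abs_sub_comm]) (le_of_not_ge hle)
    rw [bifractionalCov_comm H K (s + h) (t + h), bifractionalCov_comm H K (s + h) t,
      bifractionalCov_comm H K s (t + h), bifractionalCov_comm H K s t, sub_right_comm] at this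
    exact this
  have hle' : (t : ℝ) ≤ s := hle
  have hh : (0 : ℝ) ≤ h := h.coe_nonneg
  rw [abs_sub_comm, abs_of_nonneg (by linarith)] at hts
  have h1 := abs_mixed_difference_add_rpow_le (a := 2 * H) (by linarith) (by linarith) hK0 hK2 hd
    hd1 hh ht hs ht1 hs1
  -- As `h ≤ d`, a gap `2 d` between the left endpoints leaves `d` between the intervals.
  have h2 := abs_mixed_difference_rpow_sub_le (a := 2 * H * K) (by positivity) (by linarith) hd
    hh t.coe_nonneg hs1 (by linarith)
  have e : bifractionalCov H K (t + h) (s + h) - bifractionalCov H K (t + h) s -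
      bifractionalCov H K t (s + h) + bifractionalCov H K t s =
      2 ^ (-K) * ((((t : ℝ) + h) ^ (2 * H) + ((s : ℝ) + h) ^ (2 * H)) ^ K -
        (((t : ℝ) + h) ^ (2 * H) + (s : ℝ) ^ (2 * H)) ^ K -
        ((t : ℝ) ^ (2 * H) + ((s : ℝ) + h) ^ (2 * H)) ^ K +
        ((t : ℝ) ^ (2 * H) + (s : ℝ) ^ (2 * H)) ^ K -
        (((s : ℝ) + h - (t + h)) ^ (2 * H * K) - ((s : ℝ) - (t + h)) ^ (2 * H * K) -
          ((s : ℝ) + h - t) ^ (2 * H * K) + ((s : ℝ) - t) ^ (2 * H * K))) := by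
    unfold bifractionalCov
    rw [abs_sub_comm _ ((s + h : ℝ≥0) : ℝ), abs_sub_comm _ (s : ℝ),
      abs_sub_comm _ ((s + h : ℝ≥0) : ℝ), abs_sub_comm _ (s : ℝ)]
    push_cast
    rw [abs_of_nonneg (by linarith : 0 ≤ (s : ℝ) + h - (t + h)),
      abs_of_nonneg (by linarith : 0 ≤ (s : ℝ) - (t + h)),
      abs_of_nonneg (by linarith : 0 ≤ (s : ℝ) + h - t),
      abs_of_nonneg (by linarith : 0 ≤ (s : ℝ) - t)]
    ring
  have hp : (2 : ℝ) ^ (-K) ≤ 1 := Real.rpow_le_one_of_one_le_of_nonpos (by norm_num) (by linarith)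
  have h3 : (d ^ 2)⁻¹ ≤ (d ^ 6)⁻¹ := by
    rw [inv_le_inv₀ (by positivity) (by positivity)]
    exact pow_le_pow_of_le_one hd.le hd1 (by norm_num)
  rw [e, abs_mul, abs_of_pos (by positivity : (0 : ℝ) < 2 ^ (-K))]
  refine (mul_le_of_le_one_left (abs_nonneg _) hp).trans ((abs_sub _ _).trans ?_)
  have h4 : 2 * (d ^ 2)⁻¹ * (h : ℝ) ^ 2 ≤ 2 * (d ^ 6)⁻¹ * (h : ℝ) ^ 2 := by gcongr
  linarith

/-! ### Second moments, Chebyshev and Borel-Cantelli. -/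

section SecondMoment

variable {T Ω : Type*} [MeasurableSpace T] [MeasurableSpace Ω] {μ : Measure T} {P : Measure Ω}

lemma lintegral_sq_lintegral_of_measurable [SFinite μ] [SFinite P] {F : T → Ω → ℝ≥0∞}
    (hF : Measurable (Function.uncurry F)) :
    ∫⁻ ω, (∫⁻ t, F t ω ∂μ) ^ 2 ∂P = ∫⁻ t, ∫⁻ s, ∫⁻ ω, F t ω * F s ω ∂P ∂μ ∂μ := by
  have h1 (ω : Ω) : Measurable fun t => F t ω := hF.comp measurable_prodMk_right
  have e (ω : Ω) : (∫⁻ t, F t ω ∂μ) ^ 2 = ∫⁻ z, F z.1 ω * F z.2 ω ∂(μ.prod μ) := by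
    rw [sq, lintegral_prod_mul (h1 ω).aemeasurable (h1 ω).aemeasurable]
  have m : Measurable fun z : Ω × T × T => F z.2.1 z.1 * F z.2.2 z.1 :=
    (hF.comp (measurable_snd.fst.prodMk measurable_fst)).mul
      (hF.comp (measurable_snd.snd.prodMk measurable_fst))
  simp_rw [e]
  rw [lintegral_lintegral_swap m.aemeasurable, lintegral_prod]
  exact (m.comp measurable_swap).lintegral_prod_right'.aemeasurable

/-- Joint measurability up to a null set suffices: by Fubini the exceptional set has null sections
in both directions, one for each side of the identity. -/
lemma lintegral_sq_lintegral [SFinite μ] [SFinite P] {F : T → Ω → ℝ≥0∞}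
    (hF : AEMeasurable (Function.uncurry F) (μ.prod P)) :
    ∫⁻ ω, (∫⁻ t, F t ω ∂μ) ^ 2 ∂P = ∫⁻ t, ∫⁻ s, ∫⁻ ω, F t ω * F s ω ∂P ∂μ ∂μ := by
  have h1 : ∀ᵐ t ∂μ, ∀ᵐ ω ∂P, F t ω = hF.mk _ (t, ω) := Measure.ae_ae_of_ae_prod hF.ae_eq_mk
  have h2 : ∀ᵐ ω ∂P, ∀ᵐ t ∂μ, F t ω = hF.mk _ (t, ω) :=
    Measure.ae_ae_of_ae_prod
      (Measure.measurePreserving_swap.quasiMeasurePreserving.ae hF.ae_eq_mk)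
  have key := lintegral_sq_lintegral_of_measurable (μ := μ) (P := P)
    (F := fun t ω => hF.mk _ (t, ω)) hF.measurable_mk
  calc _ = ∫⁻ ω, (∫⁻ t, hF.mk _ (t, ω) ∂μ) ^ 2 ∂P := by
        refine lintegral_congr_ae ?_
        filter_upwards [h2] with ω hω
        rw [lintegral_congr_ae hω]
    _ = _ := key
    _ = _ := by
        refine lintegral_congr_ae ?_
        filter_upwards [h1] with t ht
        refine lintegral_congr_ae ?_
        filter_upwards [h1] with s hs
        refine lintegral_congr_ae ?_
        filter_upwards [ht, hs] with ω h3 h4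
        rw [h3, h4]

/-- Chebyshev's inequality for an extended nonnegative random variable. -/
lemma measure_add_one_le_of_sq_le [IsProbabilityMeasure P] {Z : Ω → ℝ≥0∞}
    (hZ : AEMeasurable Z P) {A ε : ℝ≥0∞} (hA : A < ∞) (hε : ε < ∞) (h1 : ∫⁻ ω, Z ω ∂P ≤ A)
    (h2 : ∫⁻ ω, Z ω ^ 2 ∂P ≤ (∫⁻ ω, Z ω ∂P) ^ 2 + ε) : P {ω | A + 1 ≤ Z ω} ≤ ε := by
  have hm : ∫⁻ ω, Z ω ∂P < ∞ := h1.trans_lt hA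
  have hm2 : ∫⁻ ω, Z ω ^ 2 ∂P < ∞ := h2.trans_lt (ENNReal.add_lt_top.2 ⟨ENNReal.pow_lt_top hm, hε⟩)
  have hfin : ∀ᵐ ω ∂P, Z ω < ∞ := ae_lt_top' hZ hm.ne
  have hfin2 : ∀ᵐ ω ∂P, Z ω ^ 2 < ∞ := ae_lt_top' (hZ.pow_const 2) hm2.ne
  set z : Ω → ℝ := fun ω => (Z ω).toReal with hz
  have i1 : ∫ ω, z ω ∂P = (∫⁻ ω, Z ω ∂P).toReal := integral_toReal hZ hfin
  have i2 : ∫ ω, z ω ^ 2 ∂P = (∫⁻ ω, Z ω ^ 2 ∂P).toReal := by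
    rw [← integral_toReal (hZ.pow_const 2) hfin2]
    simp [hz]
  have hL : MemLp z 2 P := by
    rw [memLp_two_iff_integrable_sq hZ.ennreal_toReal.aestronglyMeasurable]
    have := integrable_toReal_of_lintegral_ne_top (hZ.pow_const 2) hm2.ne
    simpa [hz] using this
  have hv : ENNReal.ofReal (variance z P) ≤ ε := by
    rw [variance_eq_sub hL]
    refine ENNReal.ofReal_le_of_le_toReal ?_
    have : ∫ ω, z ω ^ 2 ∂P ≤ (∫ ω, z ω ∂P) ^ 2 + ε.toReal := by
      rw [i1, i2, ← ENNReal.toReal_pow, ← ENNReal.toReal_add (ENNReal.pow_lt_top hm).ne hε.ne]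
      exact ENNReal.toReal_mono
        (ENNReal.add_lt_top.2 ⟨ENNReal.pow_lt_top hm, hε⟩).ne h2
    simp only [Pi.pow_apply]
    linarith
  calc P {ω | A + 1 ≤ Z ω} ≤ P {ω | 1 ≤ |z ω - ∫ ω, z ω ∂P|} := by
        refine measure_mono_ae ?_
        filter_upwards [hfin] with ω hω hω'
        have h3 : A.toReal + 1 ≤ z ω := by
          have := ENNReal.toReal_mono hω.ne hω'
          rwa [ENNReal.toReal_add hA.ne ENNReal.one_ne_top, ENNReal.toReal_one] at this
        have h4 : ∫ ω, z ω ∂P ≤ A.toReal := by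
          rw [i1]
          exact ENNReal.toReal_mono hA.ne h1
        exact le_trans (by linarith) (le_abs_self _)
    _ ≤ ENNReal.ofReal (variance z P / 1 ^ 2) := meas_ge_le_variance_div_sq hL one_pos
    _ ≤ ε := by simpa using hv

/-- A sequence with bounded means and summable variances is almost surely bounded. -/
lemma ae_exists_forall_le_of_sq_le [IsProbabilityMeasure P] {Z : ℕ → Ω → ℝ≥0∞}
    (hZ : ∀ n, AEMeasurable (Z n) P) {A : ℝ≥0∞} {ε : ℕ → ℝ≥0∞} (hA : A < ∞)
    (hε : ∑' n, ε n ≠ ∞) (h1 : ∀ n, ∫⁻ ω, Z n ω ∂P ≤ A)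
    (h2 : ∀ n, ∫⁻ ω, Z n ω ^ 2 ∂P ≤ (∫⁻ ω, Z n ω ∂P) ^ 2 + ε n) :
    ∀ᵐ ω ∂P, ∃ M : ℝ, 1 ≤ M ∧ ∀ n, Z n ω ≤ ENNReal.ofReal M := by
  have hεn (n : ℕ) : ε n < ∞ := (ENNReal.le_tsum n).trans_lt hε.lt_top
  have hs : ∑' n, P {ω | A + 1 ≤ Z n ω} ≠ ∞ :=
    ne_top_of_le_ne_top hε (ENNReal.tsum_le_tsum fun n =>
      measure_add_one_le_of_sq_le (hZ n) hA (hεn n) (h1 n) (h2 n))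
  have hf (n : ℕ) : ∀ᵐ ω ∂P, Z n ω < ∞ := ae_lt_top' (hZ n) ((h1 n).trans_lt hA).ne
  filter_upwards [ae_eventually_notMem hs, ae_all_iff.2 hf] with ω h3 h4
  obtain ⟨N, hN⟩ := eventually_atTop.1 h3
  have hfin : A + 1 + ∑ n ∈ Finset.range N, Z n ω < ∞ :=
    ENNReal.add_lt_top.2 ⟨ENNReal.add_lt_top.2 ⟨hA, ENNReal.one_lt_top⟩,
      ENNReal.sum_lt_top.2 fun n _ => h4 n⟩
  -- Borel-Cantelli gives `A + 1` from `N` on; the finitely many earlier terms are finite and are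
  -- simply added.
  refine ⟨max 1 (A + 1 + ∑ n ∈ Finset.range N, Z n ω).toReal, le_max_left _ _, fun n => ?_⟩
  refine le_trans ?_ (ENNReal.ofReal_le_ofReal (le_max_right _ _))
  rw [ENNReal.ofReal_toReal hfin.ne]
  rcases lt_or_ge n N with h | h
  · exact (Finset.single_le_sum (f := fun n => Z n ω) (fun _ _ => zero_le)
      (Finset.mem_range.2 h)).trans le_add_self
  · exact (not_le.1 (hN n h)).le.trans le_self_add

end SecondMoment

/-- The trivial bound `1` is used where `t < d`, `s < d` or `|t - s| < 2 d`, costing `d + d + 4 d`;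
the other pairs cost `10 d`. -/
lemma setLIntegral_abs_le_of_separated {S : Set ℝ} (hS : MeasurableSet S)
    (hS1 : S ⊆ Ioo 0 1) {r : ℝ → ℝ → ℝ} {d : ℝ} (hd : 0 < d)
    (h1 : ∀ t ∈ S, ∀ s ∈ S, |r t s| ≤ 1)
    (h2 : ∀ t ∈ S, ∀ s ∈ S, d ≤ t → d ≤ s → 2 * d ≤ |t - s| → |r t s| ≤ 10 * d) :
    ∫⁻ t in S, ∫⁻ s in S, ENNReal.ofReal |r t s| ≤ ENNReal.ofReal (16 * d) := by
  have hvol : volume S ≤ 1 := (measure_mono hS1).trans (by simp)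
  have hI (a b c : ℝ) (h : b - a = c) :
      ∫⁻ s in S, (Ioo a b).indicator 1 s ≤ ENNReal.ofReal c := by
    rw [lintegral_indicator_one measurableSet_Ioo, ← h, ← Real.volume_Ioo]
    exact Measure.restrict_apply_le _ _
  have hc (c : ℝ≥0∞) : ∫⁻ _ in S, c ≤ c := by
    rw [setLIntegral_const]
    exact mul_le_of_le_one_right' hvol
  have mI (a b : ℝ) : Measurable ((Ioo a b).indicator (1 : ℝ → ℝ≥0∞)) :=
    measurable_one.indicator measurableSet_Ioo
  have pt (t : ℝ) (ht : t ∈ S) (s : ℝ) (hs : s ∈ S) : ENNReal.ofReal |r t s| ≤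
      (Ioo 0 d).indicator 1 t + ((Ioo 0 d).indicator 1 s +
        ((Ioo (t - 2 * d) (t + 2 * d)).indicator 1 s + ENNReal.ofReal (10 * d))) := by
    have h1' : ENNReal.ofReal |r t s| ≤ 1 := ENNReal.ofReal_le_one.2 (h1 t ht s hs)
    by_cases c1 : t < d
    · rw [indicator_of_mem (show t ∈ Ioo 0 d from ⟨(hS1 ht).1, c1⟩)]
      exact h1'.trans le_self_add
    by_cases c2 : s < d
    · rw [indicator_of_mem (show s ∈ Ioo 0 d from ⟨(hS1 hs).1, c2⟩)]
      exact (h1'.trans le_self_add).trans le_add_self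
    by_cases c3 : |t - s| < 2 * d
    · rw [abs_lt] at c3
      rw [indicator_of_mem (show s ∈ Ioo (t - 2 * d) (t + 2 * d) from
        ⟨by linarith, by linarith⟩)]
      exact ((h1'.trans le_self_add).trans le_add_self).trans le_add_self
    push Not at c1 c2 c3
    exact (((ENNReal.ofReal_le_ofReal (h2 t ht s hs c1 c2 c3)).trans le_add_self).trans
      le_add_self).trans le_add_self
  calc ∫⁻ t in S, ∫⁻ s in S, ENNReal.ofReal |r t s|
      ≤ ∫⁻ t in S, ((Ioo 0 d).indicator 1 t + (ENNReal.ofReal d +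
          (ENNReal.ofReal (4 * d) + ENNReal.ofReal (10 * d)))) := by
        refine setLIntegral_mono' hS fun t ht => ?_
        refine (setLIntegral_mono' hS (pt t ht)).trans ?_
        rw [lintegral_add_left measurable_const, lintegral_add_left (mI _ _),
          lintegral_add_left (mI _ _)]
        gcongr
        · exact hc _
        · exact hI _ _ _ (by ring)
        · exact hI _ _ _ (by ring)
        · exact hc _
    _ ≤ ENNReal.ofReal d + (ENNReal.ofReal d +
          (ENNReal.ofReal (4 * d) + ENNReal.ofReal (10 * d))) := by
        rw [lintegral_add_left (mI _ _)]
        gcongr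
        · exact hI _ _ _ (by ring)
        · exact hc _
    _ = ENNReal.ofReal (16 * d) := by
        rw [← ENNReal.ofReal_add (by positivity) (by positivity),
          ← ENNReal.ofReal_add (by positivity) (by positivity),
          ← ENNReal.ofReal_add (by positivity) (by positivity)]
        ring_nf

/-! ### Almost sure bounds for the normalized increments. -/

section BifractionalIncrements

variable {Ω : Type*} [MeasurableSpace Ω] {P : Measure Ω} {H K : ℝ} {B : ℝ≥0 → Ω → ℝ}

/-- The increment process `t ↦ c (B (t + h) - B t)` indexed by the real line. -/
def scaledIncr (B : ℝ≥0 → Ω → ℝ) (c h t : ℝ) (ω : Ω) : ℝ :=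
  c * (B (t + h).toNNReal ω - B t.toNNReal ω)

lemma isGaussianProcess_scaledIncr (hB : IsGaussianProcess B P) (c h : ℝ) :
    IsGaussianProcess (scaledIncr B c h) P := by
  classical
  exact hB.of_isGaussianProcess fun t ↦ ⟨{t.toNNReal, (t + h).toNNReal},
    { toFun x := c * (x ⟨(t + h).toNNReal, by simp⟩ - x ⟨t.toNNReal, by simp⟩)
      map_add' x y := by simp; ring
      map_smul' c x := by simp; ring },
    by simp [scaledIncr]⟩

lemma IsBifractionalBM.memLp_two (hB : IsBifractionalBM H K B P) (t : ℝ≥0) : MemLp (B t) 2 P :=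
  (hB.isGaussianProcess.hasGaussianLaw_eval t).memLp_two

lemma IsBifractionalBM.integral_scaledIncr (hB : IsBifractionalBM H K B P) (c h t : ℝ) :
    ∫ ω, scaledIncr B c h t ω ∂P = 0 := by
  unfold scaledIncr
  rw [integral_const_mul, integral_sub (hB.isGaussianProcess.hasGaussianLaw_eval _).integrable
    (hB.isGaussianProcess.hasGaussianLaw_eval _).integrable, hB.centred, hB.centred]
  simp

lemma IsBifractionalBM.integral_scaledIncr_mul (hB : IsBifractionalBM H K B P) (c h t s : ℝ) :
    ∫ ω, scaledIncr B c h t ω * scaledIncr B c h s ω ∂P =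
      c ^ 2 * (bifractionalCov H K (t + h).toNNReal (s + h).toNNReal -
        bifractionalCov H K (t + h).toNNReal s.toNNReal -
        bifractionalCov H K t.toNNReal (s + h).toNNReal +
        bifractionalCov H K t.toNNReal s.toNNReal) := by
  have i (a b : ℝ≥0) : Integrable (fun ω => B a ω * B b ω) P :=
    (hB.memLp_two a).integrable_mul (hB.memLp_two b)
  have i1 (a b a' b' : ℝ≥0) : Integrable (fun ω => B a ω * B b ω - B a' ω * B b' ω) P :=
    (i a b).sub (i a' b')
  have i2 (a b a' b' a'' b'' : ℝ≥0) :
      Integrable (fun ω => B a ω * B b ω - B a' ω * B b' ω - B a'' ω * B b'' ω) P :=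
    (i1 a b a' b').sub (i a'' b'')
  rw [← hB.covariance, ← hB.covariance, ← hB.covariance, ← hB.covariance,
    ← integral_sub (i _ _) (i _ _), ← integral_sub (i1 _ _ _ _) (i _ _),
    ← integral_add (i2 _ _ _ _ _ _) (i _ _), ← integral_const_mul]
  congr 1
  ext ω
  unfold scaledIncr
  ring

lemma IsBifractionalBM.integral_scaledIncr_sq_le (hB : IsBifractionalBM H K B P) {V : ℝ}
    (hV0 : 0 < V) (hV : ∀ t s : ℝ≥0, 0 < s → s ≤ t →
      bifractionalCov H K t t + bifractionalCov H K s s - 2 * bifractionalCov H K t s ≤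
        V * ((t : ℝ) - s) ^ (2 * H * K)) {h t : ℝ} (hh : 0 < h) (ht : 0 < t) :
    ∫ ω, scaledIncr B (√V * h ^ (H * K))⁻¹ h t ω ^ 2 ∂P ≤ 1 := by
  simp_rw [sq]
  rw [hB.integral_scaledIncr_mul, bifractionalCov_comm H K t.toNNReal (t + h).toNNReal]
  have h1 := hV (t + h).toNNReal t.toNNReal (by simpa using ht)
    (Real.toNNReal_le_toNNReal (by linarith))
  rw [Real.coe_toNNReal _ (by linarith), Real.coe_toNNReal _ ht.le, add_sub_cancel_left] at h1
  have e : (√V * h ^ (H * K))⁻¹ ^ 2 = (V * h ^ (2 * H * K))⁻¹ := by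
    rw [inv_pow, mul_pow, Real.sq_sqrt hV0.le, ← Real.rpow_mul_natCast hh.le]
    congr 3
    push_cast
    ring
  rw [e, inv_mul_le_one₀ (by positivity)]
  linarith

lemma aemeasurable_scaledIncr [SFinite P]
    (hmeas : AEMeasurable (fun x : ℝ × Ω => B x.1.toNNReal x.2)
      ((volume.restrict (Ioo (0 : ℝ) 1)).prod P)) (c h : ℝ) :
    AEMeasurable (Function.uncurry (scaledIncr B c h))
      ((volume.restrict (shiftInterval h)).prod P) := by
  have m1 := hmeas.mono_ac (Measure.AbsolutelyContinuous.prod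
    (Measure.restrict_mono (fun _ hs => hs.1) le_rfl : volume.restrict (shiftInterval h) ≤
      volume.restrict (Ioo 0 1)).absolutelyContinuous (Measure.AbsolutelyContinuous.refl P))
  have mp := (measurePreserving_add_restrict h (measurableSet_Ioo (a := (0 : ℝ)) (b := 1))).prod
    (MeasurePreserving.id P)
  have m2 := (hmeas.comp_quasiMeasurePreserving mp.quasiMeasurePreserving).mono_ac
    (Measure.AbsolutelyContinuous.prod (Measure.restrict_mono (fun _ hs => hs.2) le_rfl :
      volume.restrict (shiftInterval h) ≤ _).absolutelyContinuous
      (Measure.AbsolutelyContinuous.refl P))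
  exact (m2.sub m1).const_mul c

lemma lintegral_lintegral_abs_cov_le [IsProbabilityMeasure P] (hB : IsBifractionalBM H K B P)
    (hH0 : 0 < H) (hH1 : H < 1) (hK0 : 0 < K) (hK2 : K ≤ 2) (hHK1 : H * K < 1) {V : ℝ}
    (hV1 : 1 ≤ V) (hV : ∀ t s : ℝ≥0, 0 < s → s ≤ t →
      bifractionalCov H K t t + bifractionalCov H K s s - 2 * bifractionalCov H K t s ≤
        V * ((t : ℝ) - s) ^ (2 * H * K)) {h : ℝ} (hh : 0 < h) (hh1 : h ≤ 1) :
    ∫⁻ t in shiftInterval h, ∫⁻ s in shiftInterval h,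
      ENNReal.ofReal |∫ ω, scaledIncr B (√V * h ^ (H * K))⁻¹ h t ω *
        scaledIncr B (√V * h ^ (H * K))⁻¹ h s ω ∂P| ≤
      ENNReal.ofReal (16 * h ^ ((1 - H * K) / 6)) := by
  -- This exponent gives `h ^ 2 = d ^ 12 * h ^ (2HK)`, so the normalized covariance `h ^ (-2HK) * d
  -- ^ (-6) * h ^ 2` equals `d ^ 6 ≤ d`.
  set d : ℝ := h ^ ((1 - H * K) / 6) with hdef
  have hHK0 : 0 < H * K := mul_pos hH0 hK0
  have hV0 : 0 < V := by linarith
  have hd : 0 < d := by positivity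
  have hd1 : d ≤ 1 := Real.rpow_le_one hh.le hh1 (by linarith)
  have hhd : h ≤ d := by
    rw [hdef]
    simpa using Real.rpow_le_rpow_of_exponent_ge hh hh1 (by linarith : (1 - H * K) / 6 ≤ 1)
  refine setLIntegral_abs_le_of_separated (measurableSet_shiftInterval h) (fun _ hs => hs.1) hd
    ?_ ?_
  · intro t ht s hs
    have hg := isGaussianProcess_scaledIncr hB.isGaussianProcess (√V * h ^ (H * K))⁻¹ h
    exact abs_integral_mul_le_one (hg.hasGaussianLaw_eval t).memLp_two
      (hg.hasGaussianLaw_eval s).memLp_two (hB.integral_scaledIncr_sq_le hV0 hV hh ht.1.1)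
      (hB.integral_scaledIncr_sq_le hV0 hV hh hs.1.1)
  · intro t ht s hs htd hsd hts
    have ht0 : 0 < t := ht.1.1
    have hs0 : 0 < s := hs.1.1
    have key := abs_bifractionalCov_incr_le (H := H) (K := K) (t := t.toNNReal)
      (s := s.toNNReal) (h := h.toNNReal) hH0 hH1 hK0 hK2 hHK1 hd hd1
    rw [← Real.toNNReal_add ht0.le hh.le, ← Real.toNNReal_add hs0.le hh.le] at key
    simp only [Real.coe_toNNReal _ ht0.le, Real.coe_toNNReal _ hs0.le,
      Real.coe_toNNReal _ hh.le] at key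
    have key := key hhd htd hsd ht.2.2.le hs.2.2.le hts
    rw [hB.integral_scaledIncr_mul, abs_mul, abs_of_nonneg (sq_nonneg _)]
    have e1 : h ^ 2 = d ^ 12 * (h ^ (H * K)) ^ 2 := by
      rw [hdef, ← Real.rpow_mul_natCast hh.le, ← Real.rpow_mul_natCast hh.le,
        ← Real.rpow_add hh, ← Real.rpow_natCast h 2]
      congr 1
      push_cast
      ring
    have hα : 0 < h ^ (H * K) := by positivity
    calc (√V * h ^ (H * K))⁻¹ ^ 2 * _ ≤
          (√V * h ^ (H * K))⁻¹ ^ 2 * (10 * (d ^ 6)⁻¹ * h ^ 2) := by gcongr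
      _ = V⁻¹ * (10 * d ^ 6) := by
        rw [inv_pow, mul_pow, Real.sq_sqrt hV0.le, e1]
        field_simp
      _ ≤ 1 * (10 * d) := by
        gcongr
        · exact inv_le_one_of_one_le₀ hV1
        · exact pow_le_of_le_one hd.le hd1 (by norm_num)
      _ = 10 * d := one_mul _

/-- Both squares become double integrals over `S`, where the pairwise Gaussian bound applies
pointwise. -/
lemma lintegral_sq_lintegral_expSq_le [IsProbabilityMeasure P] {S : Set ℝ}
    (hS : MeasurableSet S) {X : ℝ → Ω → ℝ} (hX : IsGaussianProcess X P)
    (hXm : AEMeasurable (Function.uncurry X) ((volume.restrict S).prod P))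
    (hX0 : ∀ t, ∫ ω, X t ω ∂P = 0) (hX1 : ∀ t ∈ S, ∫ ω, X t ω ^ 2 ∂P ≤ 1) :
    ∫⁻ ω, (∫⁻ t in S, expSq (X t ω)) ^ 2 ∂P ≤ (∫⁻ ω, (∫⁻ t in S, expSq (X t ω)) ∂P) ^ 2 +
      (∫⁻ t in S, ∫⁻ s in S, ENNReal.ofReal |∫ ω, X t ω * X s ω ∂P|) * gaussExpMoment ^ 2 := by
  have hF : AEMeasurable (Function.uncurry fun t ω => expSq (X t ω))
      ((volume.restrict S).prod P) := measurable_expSq.comp_aemeasurable hXm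
  have hm : AEMeasurable (fun t => ∫⁻ ω, expSq (X t ω) ∂P) (volume.restrict S) :=
    hF.lintegral_prod_right'
  have hA : gaussExpMoment ^ 2 ≠ ∞ := (ENNReal.pow_lt_top gaussExpMoment_lt_top).ne
  rw [lintegral_sq_lintegral hF, ← lintegral_lintegral_swap hF, sq (∫⁻ t in S, _),
    ← lintegral_lintegral_mul hm hm, ← lintegral_mul_const' _ _ hA]
  have hm2 : AEMeasurable (fun t => ∫⁻ s in S, (∫⁻ ω, expSq (X t ω) ∂P) *
      ∫⁻ ω, expSq (X s ω) ∂P) (volume.restrict S) := by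
    simp_rw [lintegral_const_mul'' _ hm]
    exact hm.mul_const _
  rw [← lintegral_add_left' hm2]
  refine setLIntegral_mono' hS fun t ht => ?_
  rw [← lintegral_mul_const' _ _ hA, ← lintegral_add_left' (hm.const_mul _)]
  refine setLIntegral_mono' hS fun s hs => ?_
  exact lintegral_expSq_mul_le hX.hasGaussianLaw_prodMk (hX0 t) (hX0 s) (hX1 t ht) (hX1 s hs)

lemma lintegral_lintegral_expSq_le [IsProbabilityMeasure P] {S : Set ℝ}
    (hS : MeasurableSet S) (hS1 : S ⊆ Ioo 0 1) {X : ℝ → Ω → ℝ} (hX : IsGaussianProcess X P)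
    (hXm : AEMeasurable (Function.uncurry X) ((volume.restrict S).prod P))
    (hX0 : ∀ t, ∫ ω, X t ω ∂P = 0) (hX1 : ∀ t ∈ S, ∫ ω, X t ω ^ 2 ∂P ≤ 1) :
    ∫⁻ ω, (∫⁻ t in S, expSq (X t ω)) ∂P ≤ gaussExpMoment := by
  have hF : AEMeasurable (Function.uncurry fun t ω => expSq (X t ω))
      ((volume.restrict S).prod P) := measurable_expSq.comp_aemeasurable hXm
  rw [← lintegral_lintegral_swap hF]
  calc _ ≤ ∫⁻ _ in S, gaussExpMoment := setLIntegral_mono' hS fun t ht =>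
        lintegral_expSq_le (hX.hasGaussianLaw_eval t) (hX0 t) (hX1 t ht)
    _ ≤ gaussExpMoment := by
        rw [setLIntegral_const]
        exact mul_le_of_le_one_right' ((measure_mono hS1).trans (by simp))

/-- The dyadic increments of bifractional Brownian motion are almost surely uniformly
square-exponentially integrable. -/
lemma IsBifractionalBM.ae_exists_expSq_incr_le [IsProbabilityMeasure P]
    (hB : IsBifractionalBM H K B P) (hH0 : 0 < H) (hH1 : H < 1) (hK0 : 0 < K) (hK2 : K ≤ 2)
    (hHK1 : H * K < 1)
    (hmeas : AEMeasurable (fun x : ℝ × Ω => B x.1.toNNReal x.2)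
      ((volume.restrict (Ioo (0 : ℝ) 1)).prod P)) {V : ℝ} (hV1 : 1 ≤ V)
    (hV : ∀ t s : ℝ≥0, 0 < s → s ≤ t →
      bifractionalCov H K t t + bifractionalCov H K s s - 2 * bifractionalCov H K t s ≤
        V * ((t : ℝ) - s) ^ (2 * H * K)) :
    ∀ᵐ ω ∂P, ∃ M : ℝ, 1 ≤ M ∧ ∀ n : ℕ, ∫⁻ t in shiftInterval ((1 / 2) ^ n),
      expSq (scaledIncr B (√V * ((1 / 2) ^ n) ^ (H * K))⁻¹ ((1 / 2) ^ n) t ω) ≤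
        ENNReal.ofReal M := by
  have hV0 : 0 < V := by linarith
  have hn0 (n : ℕ) : (0 : ℝ) < (1 / 2) ^ n := by positivity
  have hn1 (n : ℕ) : ((1 : ℝ) / 2) ^ n ≤ 1 := pow_le_one₀ (by norm_num) (by norm_num)
  have hA2 : gaussExpMoment ^ 2 ≠ ∞ := (ENNReal.pow_lt_top gaussExpMoment_lt_top).ne
  have hm (n : ℕ) := aemeasurable_scaledIncr hmeas (√V * ((1 / 2) ^ n) ^ (H * K))⁻¹ ((1 / 2) ^ n)
  have hg (n : ℕ) := isGaussianProcess_scaledIncr hB.isGaussianProcess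
    (√V * ((1 / 2) ^ n) ^ (H * K))⁻¹ ((1 / 2) ^ n)
  have h1 (n : ℕ) : ∀ t ∈ shiftInterval ((1 / 2) ^ n), _ := fun t ht =>
    hB.integral_scaledIncr_sq_le hV0 hV (hn0 n) ht.1.1
  refine ae_exists_forall_le_of_sq_le (A := gaussExpMoment)
    (ε := fun n => ENNReal.ofReal (16 * ((1 / 2) ^ ((1 - H * K) / 6)) ^ n) * gaussExpMoment ^ 2)
    (fun n => ?_) gaussExpMoment_lt_top ?_ (fun n => ?_) (fun n => ?_)
  · have := measurable_expSq.comp_aemeasurable (hm n)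
    exact this.lintegral_prod_left'
  · rw [ENNReal.tsum_mul_right]
    refine ENNReal.mul_ne_top ?_ hA2
    have hq : ((1 : ℝ) / 2) ^ ((1 - H * K) / 6) < 1 :=
      Real.rpow_lt_one (by norm_num) (by norm_num) (by linarith)
    exact ((summable_geometric_of_lt_one (by positivity) hq).mul_left 16).tsum_ofReal_ne_top
  · exact lintegral_lintegral_expSq_le (measurableSet_shiftInterval _) (fun _ hs => hs.1) (hg n)
      (hm n) (hB.integral_scaledIncr _ _) (h1 n)
  · refine (lintegral_sq_lintegral_expSq_le (measurableSet_shiftInterval _) (hg n) (hm n)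
      (hB.integral_scaledIncr _ _) (h1 n)).trans ?_
    gcongr
    refine (lintegral_lintegral_abs_cov_le hB hH0 hH1 hK0 hK2 hHK1 hV1 hV (hn0 n) (hn1 n)).trans
      (le_of_eq ?_)
    rw [← Real.rpow_natCast, ← Real.rpow_natCast, ← Real.rpow_mul (by norm_num),
      ← Real.rpow_mul (by norm_num), mul_comm (n : ℝ)]

lemma IsBifractionalBM.ae_exists_expSq_le [IsProbabilityMeasure P]
    (hB : IsBifractionalBM H K B P) (hHK0 : 0 < H * K)
    (hmeas : AEMeasurable (fun x : ℝ × Ω => B x.1.toNNReal x.2)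
      ((volume.restrict (Ioo (0 : ℝ) 1)).prod P)) :
    ∀ᵐ ω ∂P, ∃ M : ℝ, 1 ≤ M ∧ ∫⁻ t in Ioo (0 : ℝ) 1, expSq (B t.toNNReal ω) ≤
      ENNReal.ofReal M := by
  have h := lintegral_lintegral_expSq_le (P := P) (X := fun t : ℝ => B t.toNNReal)
    measurableSet_Ioo le_rfl (hB.isGaussianProcess.comp_right Real.toNNReal) hmeas
    (fun t => hB.centred _) fun t ht => by
      simp_rw [sq]
      rw [hB.covariance, bifractionalCov_self hHK0, Real.coe_toNNReal _ ht.1.le]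
      exact Real.rpow_le_one ht.1.le ht.2.le (by linarith)
  have hF := measurable_expSq.comp_aemeasurable hmeas
  filter_upwards [ae_lt_top' hF.lintegral_prod_left' (h.trans_lt gaussExpMoment_lt_top).ne]
    with ω hω
  refine ⟨max 1 (∫⁻ t in Ioo (0 : ℝ) 1, expSq (B t.toNNReal ω)).toReal, le_max_left _ _, ?_⟩
  refine le_trans ?_ (ENNReal.ofReal_le_ofReal (le_max_right _ _))
  exact (ENNReal.ofReal_toReal hω.ne).ge

end BifractionalIncrements

theorem mainTheorem2 {Ω : Type*} [MeasurableSpace Ω] (P : Measure Ω) [IsProbabilityMeasure P]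
    (H K : ℝ) (hH : H ∈ Ioo (0 : ℝ) 1) (hK : K ∈ Ioc (0 : ℝ) 2) (hHK : H * K ∈ Ioo (0 : ℝ) 1)
    (B : ℝ≥0 → Ω → ℝ) (hB : IsBifractionalBM H K B P)
    (hmeas : AEMeasurable (fun x : ℝ × Ω => B x.1.toNNReal x.2)
      ((volume.restrict (Ioo (0 : ℝ) 1)).prod P)) :
    ∀ᵐ ω ∂P, MemBesovOrlicz (H * K) 2 (fun t : ℝ => B t.toNNReal ω) := by
  obtain ⟨V, hV1, hV⟩ := exists_bifractionalCov_incr_le hHK.1 hHK.2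
  have hV0 : 0 < V := by linarith
  filter_upwards [hB.ae_exists_expSq_incr_le hH.1 hH.2 hK.1 hK.2 hHK.2 hmeas hV1 hV,
    hB.ae_exists_expSq_le hHK.1 hmeas, hmeas.aestronglyMeasurable.prodMk_right]
    with ω ⟨M, hM1, hM⟩ ⟨N, hN1, hN⟩ hf
  -- The constants are `2 σ M` from `eLpNorm_le_of_lintegral_expSq`, with `σ = 1` for the path and
  -- `σ = √V 2 ^ (-nHK)` for the increments.
  refine memBesovOrlicz_of_dyadic (C := 2 * 1 * N) (D := 2 * √V * M) hHK.1 (by positivity) hf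
    (fun p hp => ?_) fun p hp n => ?_
  · exact eLpNorm_le_of_lintegral_expSq one_pos hN1 (by simpa using hN) hp
  · have hσ : 0 < √V * ((1 / 2 : ℝ) ^ n) ^ (H * K) := by positivity
    refine (eLpNorm_le_of_lintegral_expSq hσ hM1 ?_ hp).trans
      (ENNReal.ofReal_le_ofReal (le_of_eq ?_))
    · refine le_trans (le_of_eq (lintegral_congr fun t => ?_)) (hM n)
      rw [scaledIncr, div_eq_inv_mul]
    · rw [← Real.rpow_natCast, ← Real.rpow_natCast, ← Real.rpow_mul (by norm_num),
        ← Real.rpow_mul (by norm_num), mul_comm (n : ℝ)]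
      ring
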